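/- For $\alpha,\beta>0$ write $$\mathrm{D}_+(\alpha,\beta)=\Big(\frac{\sqrt\alpha-\sqrt\beta}{\sqrt2}\Big)^2,\qquad \mathrm{T}_c(\alpha,\beta)=\frac{\alpha+\beta}{2}.$$ For $n\ge1$ and $p,q,s\in[0,1]$, the correlated stochastic block model $(G_1,G_2)\sim\mathrm{CSBM}(n,p,q,s)$ is defined as follows. Draw community labels $\sigma_*(i)\in\{+1,-1\}$, $i\in[n]$, i.i.d. uniformly at random. Given $\sigma_*$, draw a parent graph $G$ on $[n]$ in which distinct vertices $i,j$ are adjacent, independently over unordered pairs, with probability $p$ if $\sigma_*(i)=\sigma_*(j)$ and with probability $q$ otherwise. Given $G$, form $G_1$ by keeping each edge of $G$ independently with probability $s$, and form $G_2'$ independently in the same way. Let $\pi_*$ be a uniformly random permutation of $[n]$, independent of everything else, and let $G_2$ be obtained from $G_2'$ by relabelling each vertex $i$ as $\pi_*(i)$. The overlap of two labelings $\sigma,\tau\in\{+1,-1\}^n$ is $\mathsf{ov}(\sigma,\tau)=\frac1n\big|\sum_{i=1}^n\sigma(i)\tau(i)\big|$; it equals $1$ if and only if $\sigma=\tau$ or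 $\sigma=-\tau$. **Theorem.** Fix constants $\alpha,\beta>0$ and $s\in[0,1]$. For all $n$ large enough that $\alpha\frac{\log n}{n},\beta\frac{\log n}{n}\le1$, let $(G_1,G_2)\sim\mathrm{CSBM}\big(n,\alpha\frac{\log n}{n},\beta\frac{\log n}{n},s\big)$. Suppose that $$\big(1-(1-s)^2\big)\,\mathrm{D}_+(\alpha,\beta)<1$$ or that $$s^2\,\mathrm{T}_c(\alpha,\beta)+s(1-s)\,\mathrm{D}_+(\alpha,\beta)<1.$$ Then for any estimator $\widetilde\sigma=\widetilde\sigma(G_1,G_2)$, that is, any sequence of functions assigning to a pair of graphs on $[n]$ a labeling in $\{+1,-1\}^n$, $$\lim_{n\to\infty}\mathbb{P}\big(\mathsf{ov}(\widetilde\sigma(G_1,G_2),\sigma_*)=1\big)=0.$$ -/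

import Mathlib

/-!
Given the two graphs, the posterior law of the labels is proportional to the likelihood. Call a
vertex good if its marked pairs are equally many towards either community. Exchanging the labels of
two good vertices of opposite labels leaves the graphs unchanged and does not decrease the
likelihood, so if there are `K` disjoint blocks of vertices, each with such a pair, then the true
labels compete with `K` alternatives that are no less likely, and are recovered with probability at
most `2 / K` (the `2` accounts for the global sign).

In the first case the marked pairs are the edges of the union of the two graphs, and only labels are
exchanged. In the second case they are the edges of the first graph that are not edges of the
second, and the two vertices also exchange their edges in the second graph, which the hidden
permutation conceals. Either way a vertex is good with probability `n ^ (-θ + o(1))`, where `θ < 1`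
is the left-hand side of the hypothesis: this is the probability that two Poisson variables both
equal the geometric mean of their means. Hence blocks of `o(n / log n)` vertices contain good
vertices of both labels with high probability, and `K` is arbitrary.
-/

open Filter Topology

namespace CorrelatedSBM

/-- The Chernoff-Hellinger divergence `D₊(α, β) = ((√α - √β) / √2)²`. -/
noncomputable def DPlus (α β : ℝ) : ℝ := ((√α - √β) / √2) ^ 2

/-- The connectivity threshold `T_c(α, β) = (α + β) / 2`. -/
noncomputable def Tc (α β : ℝ) : ℝ := (α + β) / 2

/-- Community labelings of `n` vertices; `ℤˣ` is the set `{+1, -1}`. -/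
abbrev Labeling (n : ℕ) : Type := Fin n → ℤˣ

/-- The overlap `(1 / n) |∑ i, a i * b i|` of two labelings. -/
noncomputable def overlap {n : ℕ} (a b : Labeling n) : ℝ :=
  (1 / (n : ℝ)) * |∑ i, ((a i : ℤ) : ℝ) * ((b i : ℤ) : ℝ)|

/-- The joint law of independent random variables with laws `P i`, for `i` in a finite type. -/
noncomputable def indep {ι : Type} [Fintype ι] [DecidableEq ι] {κ : Type} [Fintype κ]
    (P : ι → PMF κ) : PMF (ι → κ) :=
  PMF.ofFintype (fun x => ∏ i, P i (x i)) (by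
    have h : ∀ i, ∑ a, P i a = 1 := fun i => by
      rw [← tsum_fintype (L := .unconditional _)]
      exact (P i).tsum_coe
    rw [← Fintype.prod_sum (fun i a => P i a)]
    simp [h])

/-- The Bernoulli distribution of a Boolean with parameter `p ∈ [0, 1]`. -/
noncomputable def bern (p : unitInterval) : PMF Bool :=
  PMF.ofFintype (fun b => ENNReal.ofReal (if b then (p : ℝ) else 1 - p)) (by
    rw [Fintype.sum_bool, if_pos rfl, if_neg (by simp),
      ← ENNReal.ofReal_add p.2.1 (sub_nonneg.2 p.2.2)]
    simp)

/-- A random graph on `n` labelled vertices in which every pair `e` of distinct vertices is an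
edge with probability `w e`, independently over the pairs (`SimpleGraph.fromEdgeSet` discards the
degenerate pairs on the diagonal). -/
noncomputable def randomGraph {n : ℕ} (w : Sym2 (Fin n) → unitInterval) : PMF (SimpleGraph (Fin n)) :=
  (indep fun e => bern (w e)).map fun x => SimpleGraph.fromEdgeSet {e | x e = true}

open Classical in
/-- The stochastic block model conditioned on its community labels `σ`: two distinct vertices are
adjacent with probability `p` if they have the same label, and with probability `q` otherwise.
(The unordered pair `e.map σ` of labels is diagonal if and only if the two labels agree.) -/
noncomputable def blockGraph {n : ℕ} (p q : unitInterval) (σ : Labeling n) :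
    PMF (SimpleGraph (Fin n)) :=
  randomGraph fun e => if (e.map σ).IsDiag then p else q

open Classical in
/-- Keep each edge of `G` with probability `s`, independently; non-edges remain non-edges. -/
noncomputable def subsample {n : ℕ} (s : unitInterval) (G : SimpleGraph (Fin n)) :
    PMF (SimpleGraph (Fin n)) :=
  randomGraph fun e => if e ∈ G.edgeSet then s else 0

/-- An outcome of the correlated stochastic block model: the community labels `σ` (of the vertices
of the first graph), the hidden permutation `π`, and the two graphs `G₁` and `G₂`. -/
structure Outcome (n : ℕ) where
  σ : Labeling n
  π : Equiv.Perm (Fin n)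
  G₁ : SimpleGraph (Fin n)
  G₂ : SimpleGraph (Fin n)

/-- All sets of outcomes are events. -/
instance (n : ℕ) : MeasurableSpace (Outcome n) := ⊤

/-- The correlated stochastic block model `CSBM(n, p, q, s)`: i.i.d. uniform labels `σ`; a parent
graph `G` drawn from the block model with labels `σ`; two independent subsamplings `G₁`, `G₂'` of
`G`; an independent uniformly random permutation `π`; and `G₂`, which is `G₂'` with each vertex `i`
relabelled as `π i`. -/
noncomputable def CSBM (n : ℕ) (p q s : unitInterval) : PMF (Outcome n) :=
  (indep fun _ : Fin n => PMF.uniformOfFintype ℤˣ).bind fun σ =>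
  (blockGraph p q σ).bind fun G =>
  (subsample s G).bind fun G₁ =>
  (subsample s G).bind fun G₂' =>
  (PMF.uniformOfFintype (Equiv.Perm (Fin n))).bind fun π =>
  PMF.pure ⟨σ, π, G₁, G₂'.map π⟩

/-- An estimator of the community labels on `n` vertices is a function of the two graphs. -/
abbrev Estimator (n : ℕ) : Type :=
  SimpleGraph (Fin n) → SimpleGraph (Fin n) → Labeling n

end CorrelatedSBM

open CorrelatedSBM

namespace CorrelatedSBM

/-! ### Products of probability mass functions -/

section Independence

variable {ι κ κ' : Type} [Fintype ι] [DecidableEq ι] [Fintype κ] [Fintype κ']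

lemma indep_apply (P : ι → PMF κ) (x : ι → κ) : indep P x = ∏ i, P i (x i) := rfl

lemma indep_bind (P : ι → PMF κ) (Q : ι → κ → PMF κ') :
    indep (fun i => (P i).bind (Q i)) = (indep P).bind fun x => indep fun i => Q i (x i) := by
  ext y
  simp only [PMF.bind_apply, indep_apply, tsum_fintype, ← Finset.prod_mul_distrib]
  rw [← Fintype.prod_sum (fun i a => P i a * Q i a (y i))]

lemma indep_pure (f : ι → κ) : indep (fun i => PMF.pure (f i)) = PMF.pure f := by
  classical
  ext y
  simp only [indep_apply, PMF.pure_apply, Fintype.prod_ite_zero, Finset.prod_const_one,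
    funext_iff]

lemma indep_map (P : ι → PMF κ) (f : ι → κ → κ') :
    indep (fun i => (P i).map (f i)) = (indep P).map fun x i => f i (x i) := by
  simp only [PMF.map, indep_bind, Function.comp_def, indep_pure]

lemma toMeasure_indep [MeasurableSpace κ] [MeasurableSingletonClass κ] (P : ι → PMF κ) :
    (indep P).toMeasure = MeasureTheory.Measure.pi fun i => (P i).toMeasure := by
  refine MeasureTheory.Measure.ext_of_singleton fun x => ?_
  rw [MeasureTheory.Measure.pi_singleton]
  simp only [PMF.toMeasure_apply_singleton _ _ (measurableSet_singleton _), indep_apply]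

lemma toOuterMeasure_bind_le {α β : Type*} (P : PMF α) (f : α → PMF β) {A : Set α} {s : Set β}
    {b : ENNReal} (hb : ∀ a ∉ A, (f a).toOuterMeasure s ≤ b) :
    (P.bind f).toOuterMeasure s ≤ P.toOuterMeasure A + b := by
  classical
  rw [PMF.toOuterMeasure_bind_apply, PMF.toOuterMeasure_apply]
  calc ∑' a, P a * (f a).toOuterMeasure s ≤ ∑' a, (A.indicator P a + P a * b) := by
        refine ENNReal.tsum_le_tsum fun a => ?_
        by_cases ha : a ∈ A
        · rw [Set.indicator_of_mem ha]
          refine le_add_right (mul_le_of_le_one_right' ?_)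
          exact ((f a).toOuterMeasure.mono s.subset_univ).trans_eq
            (((f a).toOuterMeasure_apply_eq_one_iff _).2 (Set.subset_univ _))
        · rw [Set.indicator_of_notMem ha, zero_add]
          gcongr
          exact hb a ha
    _ = ∑' a, A.indicator P a + b := by
        rw [ENNReal.tsum_add, ENNReal.tsum_mul_right, P.tsum_coe, one_mul]

end Independence

/-! ### The correlated block model on pairs of vertices -/

/-- The graph whose edges are the pairs of distinct vertices at which `y` is true. -/
abbrev graphOf {n : ℕ} (y : Sym2 (Fin n) → Bool) : SimpleGraph (Fin n) :=
  SimpleGraph.fromEdgeSet {e | y e = true}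

lemma randomGraph_congr {n : ℕ} {w w' : Sym2 (Fin n) → unitInterval}
    (h : ∀ e, ¬ e.IsDiag → w e = w' e) : randomGraph w = randomGraph w' := by
  classical
  have graphOf_mask : ∀ x : Sym2 (Fin n) → Bool,
      graphOf (fun e => if e.IsDiag then false else x e) = graphOf x := fun x => by
    ext u v
    simp +contextual
  have randomGraph_eq : ∀ w : Sym2 (Fin n) → unitInterval, randomGraph w =
      (indep fun e => (bern (w e)).map fun b => if e.IsDiag then false else b).map graphOf :=
    fun w => by simp only [indep_map, PMF.map_comp, Function.comp_def, graphOf_mask, randomGraph]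
  rw [randomGraph_eq, randomGraph_eq]
  congr 2
  funext e
  by_cases he : e.IsDiag
  · simp only [if_pos he]
    exact (PMF.map_const _ _).trans (PMF.map_const _ _).symm
  · rw [h e he]

open Classical in
/-- The probability that a pair of vertices is an edge of the parent graph. -/
noncomputable def pairProb {n : ℕ} (p q : unitInterval) (σ : Labeling n) (e : Sym2 (Fin n)) :
    unitInterval :=
  if (e.map σ).IsDiag then p else q

/-- The joint law of the indicators that a given pair is an edge of the first and of the second
subsampled graph, when it is an edge of the parent graph with probability `r`. -/
noncomputable def pairLaw (r s : unitInterval) : PMF (Bool × Bool) :=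
  (bern r).bind fun g =>
  (bern (if g then s else 0)).bind fun a =>
  (bern (if g then s else 0)).map fun b => (a, b)

/-- The law of the edge indicators of the two subsampled graphs given the labels. Indicators of
degenerate pairs are included; they have no influence on the graphs. -/
noncomputable def edgeLaw {n : ℕ} (p q s : unitInterval) (σ : Labeling n) :
    PMF (Sym2 (Fin n) → Bool × Bool) :=
  indep fun e => pairLaw (pairProb p q σ e) s

lemma subsample_graphOf {n : ℕ} (s : unitInterval) (x : Sym2 (Fin n) → Bool) :
    subsample s (graphOf x) = randomGraph fun e => if x e then s else 0 :=
  randomGraph_congr fun e he => by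
    simp only [graphOf, SimpleGraph.edgeSet_fromEdgeSet, Set.mem_sdiff, Set.mem_ofPred_eq,
      Sym2.mem_diagSet, he, not_false_eq_true, and_true]

lemma blockGraph_bind_subsample {n : ℕ} (p q s : unitInterval) (σ : Labeling n) {F : Type}
    (f : SimpleGraph (Fin n) → SimpleGraph (Fin n) → PMF F) :
    ((blockGraph p q σ).bind fun G => (subsample s G).bind fun G₁ =>
      (subsample s G).bind fun G₂ => f G₁ G₂) =
    (edgeLaw p q s σ).bind fun x =>
      f (graphOf fun e => (x e).1) (graphOf fun e => (x e).2) := by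
  simp only [blockGraph, ← pairProb.eq_1]
  simp only [randomGraph, PMF.bind_map, Function.comp_def, subsample_graphOf]
  simp only [edgeLaw, pairLaw, indep_bind, indep_map, PMF.bind_bind, PMF.bind_map,
    Function.comp_def]

/-- A point of the space on which the correlated block model is realized: the labels, the edge
indicators of the two subsampled graphs before relabelling, and the hidden permutation. -/
@[ext]
structure Config (n : ℕ) where
  labels : Labeling n
  pairs : Sym2 (Fin n) → Bool × Bool
  perm : Equiv.Perm (Fin n)

/-- The pair of graphs observed by an estimator. -/
def Config.graphs {n : ℕ} (z : Config n) : SimpleGraph (Fin n) × SimpleGraph (Fin n) :=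
  (graphOf fun e => (z.pairs e).1, (graphOf fun e => (z.pairs e).2).map z.perm)

/-- The law of independent uniform community labels. -/
noncomputable def labelLaw (n : ℕ) : PMF (Labeling n) :=
  indep fun _ => PMF.uniformOfFintype ℤˣ

/-- The realization of the correlated block model on configurations. -/
noncomputable def configLaw (n : ℕ) (p q s : unitInterval) : PMF (Config n) :=
  (labelLaw n).bind fun σ => (edgeLaw p q s σ).bind fun x =>
    (PMF.uniformOfFintype (Equiv.Perm (Fin n))).map (Config.mk σ x)

lemma CSBM_eq_map_configLaw (n : ℕ) (p q s : unitInterval) :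
    CSBM n p q s =
      (configLaw n p q s).map fun z => ⟨z.labels, z.perm, z.graphs.1, z.graphs.2⟩ := by
  simp only [CSBM, configLaw, labelLaw, PMF.map_bind, PMF.map_comp, Function.comp_def,
    Config.graphs]
  simp only [blockGraph_bind_subsample p q s _ fun G₁ G₂ =>
    (PMF.uniformOfFintype (Equiv.Perm (Fin n))).bind fun π => PMF.pure (⟨_, π, G₁, G₂.map π⟩ :
      Outcome n)]
  rfl

lemma configLaw_apply {n : ℕ} (p q s : unitInterval) (z : Config n) :
    configLaw n p q s z = labelLaw n z.labels * edgeLaw p q s z.labels z.pairs *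
      (Fintype.card (Equiv.Perm (Fin n)) : ENNReal)⁻¹ := by
  classical
  obtain ⟨σ, x, π⟩ := z
  simp only [configLaw, PMF.bind_apply, PMF.map_apply, PMF.uniformOfFintype_apply,
    Config.mk.injEq]
  rw [tsum_eq_single σ fun b hb => by simp [Ne.symm hb],
    tsum_eq_single x fun b hb => by simp [Ne.symm hb],
    tsum_eq_single π fun b hb => by simp [Ne.symm hb]]
  simp only [and_self, if_true, mul_assoc]

lemma configLaw_toOuterMeasure_le {n : ℕ} (p q s : unitInterval) {A : Set (Labeling n)}
    {E : Labeling n → Set (Sym2 (Fin n) → Bool × Bool)} {b : ENNReal}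
    (hb : ∀ σ ∉ A, (edgeLaw p q s σ).toOuterMeasure (E σ) ≤ b) :
    (configLaw n p q s).toOuterMeasure {z | z.pairs ∈ E z.labels} ≤
      (labelLaw n).toOuterMeasure A + b := by
  have map_pairs : ∀ σ, ((edgeLaw p q s σ).bind fun x =>
      (PMF.uniformOfFintype (Equiv.Perm (Fin n))).map (Config.mk σ x)).map Config.pairs =
      edgeLaw p q s σ := fun σ => by
    rw [PMF.map_bind]
    refine (congrArg _ (funext fun x => ?_)).trans (PMF.bind_pure _)
    rw [PMF.map_comp]
    exact PMF.map_const _ x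
  refine toOuterMeasure_bind_le _ _ fun σ hσ => le_trans (le_of_eq ?_) (hb σ hσ)
  conv_rhs => rw [← map_pairs σ, PMF.toOuterMeasure_map_apply]
  simp only [PMF.toOuterMeasure_bind_apply, PMF.toOuterMeasure_map_apply]
  rfl

/-- The event that an estimator recovers the labels up to a global sign. -/
def recovered {n : ℕ} (est : Estimator n) : Set (Config n) :=
  {z | overlap (est z.graphs.1 z.graphs.2) z.labels = 1}

lemma CSBM_toMeasure_overlap_eq_one {n : ℕ} (p q s : unitInterval) (est : Estimator n) :
    (CSBM n p q s).toMeasure {ω | overlap (est ω.G₁ ω.G₂) ω.σ = 1} =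
      (configLaw n p q s).toOuterMeasure (recovered est) := by
  rw [PMF.toMeasure_apply_eq_toOuterMeasure_apply _ MeasurableSpace.measurableSet_top,
    CSBM_eq_map_configLaw, PMF.toOuterMeasure_map_apply]
  rfl

/-! ### Ambiguous observations -/

lemma eq_one_of_sum_units_eq_card {ι : Type*} [Fintype ι] {u : ι → ℤˣ}
    (h : ∑ i, ((u i : ℤ) : ℝ) = Fintype.card ι) (i : ι) : u i = 1 := by
  have le_one : ∀ i ∈ Finset.univ, ((u i : ℤ) : ℝ) ≤ 1 := fun i _ => by
    rcases Int.units_eq_one_or (u i) with h | h <;> simp [h]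
  have := (Finset.sum_eq_sum_iff_of_le le_one).1 (by simpa using h) i (Finset.mem_univ i)
  exact Units.ext (Int.cast_eq_one.1 this)

lemma exists_smul_eq_of_overlap_eq_one {n : ℕ} {a b : Labeling n} (h : overlap a b = 1) :
    ∃ ε : ℤˣ, b = ε • a := by
  have hn : (n : ℝ) ≠ 0 := by
    rintro hn
    simp [overlap, hn] at h
  have abs_sum : |∑ i, ((a i : ℤ) : ℝ) * ((b i : ℤ) : ℝ)| = n := by
    unfold overlap at h
    field_simp at h
    exact h
  obtain ⟨ε, hε⟩ : ∃ ε : ℤˣ, ∑ i, (((ε * a i * b i : ℤˣ) : ℤ) : ℝ) = Fintype.card (Fin n) := by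
    simp only [Units.val_mul, Int.cast_mul, mul_assoc, ← Finset.mul_sum, Fintype.card_fin]
    rcases abs_eq n.cast_nonneg |>.1 abs_sum with h | h
    · exact ⟨1, by simp [h]⟩
    · exact ⟨-1, by simp [h]⟩
  refine ⟨ε, funext fun i => ?_⟩
  have := eq_inv_of_mul_eq_one_right (eq_one_of_sum_units_eq_card hε i)
  rwa [Int.units_inv_eq_self] at this

lemma setOf_comp_swap_ne {V κ : Type*} [DecidableEq V] {f : V → κ} {a b : V} (h : f a ≠ f b) :
    {x | f (Equiv.swap a b x) ≠ f x} = {a, b} := by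
  ext x
  by_cases ha : x = a
  · simp [ha, h.symm]
  by_cases hb : x = b
  · simp [hb, h]
  simp [Equiv.swap_apply_of_ne_of_ne ha hb, ha, hb]

lemma pair_eq_of_comp_swap_eq {V κ : Type*} [DecidableEq V] {f : V → κ} {a b c d : V}
    (hab : f a ≠ f b) (hcd : f c ≠ f d) (h : f ∘ Equiv.swap a b = f ∘ Equiv.swap c d) :
    ({a, b} : Set V) = {c, d} := by
  rw [← setOf_comp_swap_ne hab, ← setOf_comp_swap_ne hcd]
  ext x
  exact (congrFun h x).congr_left.not

lemma swap_eq_swap_of_pair_eq {V : Type*} [DecidableEq V] {a b c d : V}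
    (h : ({a, b} : Set V) = {c, d}) : Equiv.swap a b = Equiv.swap c d := by
  rcases Set.pair_eq_pair_iff.1 h with ⟨rfl, rfl⟩ | ⟨rfl, rfl⟩
  · rfl
  · exact Equiv.swap_comm _ _

lemma card_mul_toOuterMeasure_le {ι α κ : Type*} [Fintype ι] [Fintype κ] (P : PMF α)
    {S : Set α} (f : ι × S → α × κ) (hf : Function.Injective f)
    (hP : ∀ x, P x.2 ≤ P (f x).1) :
    Fintype.card ι * P.toOuterMeasure S ≤ Fintype.card κ :=
  calc Fintype.card ι * P.toOuterMeasure S = ∑' x : ι × S, P x.2 := by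
        simp only [ENNReal.tsum_prod', PMF.toOuterMeasure_apply, ← tsum_subtype,
          tsum_fintype, Finset.sum_const, Finset.card_univ,
          nsmul_eq_mul]
    _ ≤ ∑' x, P (f x).1 := ENNReal.tsum_le_tsum hP
    _ ≤ ∑' y : α × κ, P y.1 := ENNReal.tsum_comp_le_tsum_of_injective hf fun y => P y.1
    _ = Fintype.card κ := by
        simp only [ENNReal.tsum_prod', tsum_fintype,
          Finset.sum_const, Finset.card_univ, nsmul_eq_mul, ENNReal.tsum_mul_left, P.tsum_coe,
          mul_one]

/-- A way to permute the labels of a configuration without changing the observed graphs. -/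
structure LabelMove (n : ℕ) where
  toFun : Equiv.Perm (Fin n) → Config n → Config n
  injective : ∀ τ, Function.Injective (toFun τ)
  labels_toFun : ∀ τ z, (toFun τ z).labels = z.labels ∘ τ
  graphs_toFun : ∀ τ z, (toFun τ z).graphs = z.graphs

/-- The configurations for which some exchange of two different labels within `H`, performed by
the move `Φ`, does not decrease the probability. -/
def exchangeable {n : ℕ} (P : PMF (Config n)) (Φ : LabelMove n) (H : Finset (Fin n)) :
    Set (Config n) :=
  {z | ∃ v ∈ H, ∃ w ∈ H, z.labels v ≠ z.labels w ∧ P z ≤ P (Φ.toFun (Equiv.swap v w) z)}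

-- The observed graphs and a global sign determine the labels of a recovered configuration, and
-- the exchanged labels then reveal the exchanged pair: the `K` moves of all these configurations
-- form a family of distinct configurations, up to the sign.
lemma card_mul_toOuterMeasure_recovered_inter_le {n K : ℕ} (P : PMF (Config n))
    (est : Estimator n) (Φ : LabelMove n) {H : Fin K → Finset (Fin n)}
    (hH : Pairwise fun i j => Disjoint (H i) (H j)) :
    K * P.toOuterMeasure (recovered est ∩ ⋂ j, exchangeable P Φ (H j)) ≤ 2 := by
  set S := recovered est ∩ ⋂ j, exchangeable P Φ (H j)
  have exists_sign : ∀ z : S, ∃ ε : ℤˣ, z.1.labels = ε • est z.1.graphs.1 z.1.graphs.2 :=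
    fun z => exists_smul_eq_of_overlap_eq_one z.2.1
  have exists_exchange : ∀ x : Fin K × S, ∃ v ∈ H x.1, ∃ w ∈ H x.1,
      x.2.1.labels v ≠ x.2.1.labels w ∧ P x.2 ≤ P (Φ.toFun (Equiv.swap v w) x.2) :=
    fun x => Set.mem_iInter.1 x.2.2.2 x.1
  choose ε hε using exists_sign
  choose v hv w hw hvw hP using exists_exchange
  suffices hf : Function.Injective fun x : Fin K × S =>
      (Φ.toFun (Equiv.swap (v x) (w x)) x.2.1, ε x.2) by
    simpa using card_mul_toOuterMeasure_le P _ hf hP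
  rintro ⟨i, z⟩ ⟨j, z'⟩ h
  obtain ⟨hmove, hsign⟩ := Prod.mk.inj h
  have graphs_eq : z.1.graphs = z'.1.graphs := by
    rw [← Φ.graphs_toFun _ z.1, hmove, Φ.graphs_toFun]
  have labels_eq : z.1.labels = z'.1.labels := by
    simp only at hsign
    rw [hε z, hε z', graphs_eq, hsign]
  have pair_eq : ({v (i, z), w (i, z)} : Set (Fin n)) = {v (j, z'), w (j, z')} := by
    have hcomp := congrArg Config.labels hmove
    rw [Φ.labels_toFun, Φ.labels_toFun, ← labels_eq] at hcomp
    exact pair_eq_of_comp_swap_eq (hvw (i, z)) (labels_eq ▸ hvw (j, z')) hcomp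
  have index_eq : i = j := by
    by_contra hij
    have hmem : v (i, z) ∈ H j := by
      rcases pair_eq ▸ Set.mem_insert (v (i, z)) _ with h | h <;> rw [h]
      exacts [hv (j, z'), hw (j, z')]
    exact Finset.disjoint_left.1 (hH hij) (hv (i, z)) hmem
  have config_eq : z.1 = z'.1 := by
    simp only [swap_eq_swap_of_pair_eq pair_eq] at hmove
    exact Φ.injective _ hmove
  rw [index_eq, Subtype.ext config_eq]

lemma toOuterMeasure_recovered_le {n K : ℕ} (hK : 0 < K) (P : PMF (Config n)) (est : Estimator n)
    (Φ : LabelMove n) {H : Fin K → Finset (Fin n)}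
    (hH : Pairwise fun i j => Disjoint (H i) (H j)) :
    P.toOuterMeasure (recovered est) ≤
      2 / K + ∑ j, P.toOuterMeasure (exchangeable P Φ (H j))ᶜ :=
  calc P.toOuterMeasure (recovered est)
      ≤ P.toOuterMeasure ((recovered est ∩ ⋂ j, exchangeable P Φ (H j)) ∪
          ⋃ j, (exchangeable P Φ (H j))ᶜ) := by
        refine P.toOuterMeasure.mono fun z hz => ?_
        rw [← Set.compl_iInter]
        exact (Classical.em _).imp (And.intro hz) id
    _ ≤ P.toOuterMeasure (recovered est ∩ ⋂ j, exchangeable P Φ (H j)) +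
          ∑ j, P.toOuterMeasure (exchangeable P Φ (H j))ᶜ :=
        (MeasureTheory.measure_union_le _ _).trans <|
          by gcongr; exact MeasureTheory.measure_iUnion_fintype_le _ _
    _ ≤ 2 / K + ∑ j, P.toOuterMeasure (exchangeable P Φ (H j))ᶜ := by
        gcongr
        rw [ENNReal.le_div_iff_mul_le (by simp [hK.ne']) (by simp), mul_comm]
        exact card_mul_toOuterMeasure_recovered_inter_le P est Φ hH

section Moves

variable {n : ℕ}

/-- Permute the labels and nothing else. -/
def relabelMove (n : ℕ) : LabelMove n where
  toFun τ z := { z with labels := z.labels ∘ τ }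
  injective τ z z' h := by
    simp only [Config.mk.injEq] at h
    exact Config.ext (τ.surjective.injective_comp_right h.1) h.2.1 h.2.2
  labels_toFun _ _ := rfl
  graphs_toFun _ _ := rfl

lemma graphOf_comp_map_map (y : Sym2 (Fin n) → Bool) (τ : Equiv.Perm (Fin n)) :
    (graphOf fun e => y (e.map τ)).map τ = graphOf y := by
  ext u v
  simp only [SimpleGraph.map_adj', SimpleGraph.fromEdgeSet_adj, Set.mem_ofPred_eq, Sym2.map_mk]
  constructor
  · rintro ⟨huv, a, b, ⟨hy, -⟩, rfl, rfl⟩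
    exact ⟨hy, huv⟩
  · rintro ⟨hy, huv⟩
    exact ⟨huv, τ.symm u, τ.symm v, ⟨by simpa using hy, by simpa using huv⟩, by simp, by simp⟩

/-- Permute the labels, and let the vertices exchange their edges in the second graph
accordingly, with the hidden permutation hiding this exchange. -/
def rematchMove (n : ℕ) : LabelMove n where
  toFun τ z :=
    ⟨z.labels ∘ τ, fun e => ((z.pairs e).1, (z.pairs (e.map τ)).2), z.perm * τ⟩
  injective τ z z' h := by
    simp only [Config.mk.injEq, mul_left_inj] at h
    obtain ⟨hlabels, hpairs, hperm⟩ := h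
    refine Config.ext (τ.surjective.injective_comp_right hlabels) (funext fun e => ?_) hperm
    refine Prod.ext ((Prod.ext_iff.1 (congrFun hpairs e)).1) ?_
    simpa [Sym2.map_map] using (Prod.ext_iff.1 (congrFun hpairs (e.map τ.symm))).2
  labels_toFun _ _ := rfl
  graphs_toFun τ z := by
    refine Prod.ext rfl ?_
    simp only [Config.graphs, Equiv.Perm.coe_mul]
    rw [← SimpleGraph.map_map, graphOf_comp_map_map fun e => (z.pairs e).2]

end Moves

/-! ### Exchanging labels at balanced vertices -/

section Swap

variable {V : Type*}

lemma star_injective (v : V) : Function.Injective fun u : V => s(v, u) :=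
  fun _ _ h => Sym2.congr_right.1 h

variable [DecidableEq V]

/-- The pairs formed by `v` and the elements of `S`. -/
def star (v : V) (S : Finset V) : Finset (Sym2 V) := S.image fun u => s(v, u)

lemma prod_filter_mem_eq_prod_filter_mk [Fintype V] (Z : Finset (Sym2 V)) (v : V) (f : Sym2 V → ℝ) :
    ∏ e ∈ Z with v ∈ e, f e = ∏ u with s(v, u) ∈ Z, f s(v, u) := by
  rw [← Finset.prod_image (star_injective v).injOn]
  congr 1
  ext e
  simp only [Finset.mem_filter, Finset.mem_image, Finset.mem_univ, true_and]
  constructor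
  · rintro ⟨he, hv⟩
    obtain ⟨u, rfl⟩ := Sym2.mem_iff_exists.1 hv
    exact ⟨u, he, rfl⟩
  · rintro ⟨u, he, rfl⟩
    exact ⟨he, Sym2.mem_mk_left v u⟩

lemma map_swap_of_notMem {v w : V} {e : Sym2 V} (hv : v ∉ e) (hw : w ∉ e) :
    e.map (Equiv.swap v w) = e := by
  have swap_eq : ∀ u ∈ e, Equiv.swap v w u = id u := fun u hu =>
    Equiv.swap_apply_of_ne_of_ne (ne_of_mem_of_not_mem hu hv) (ne_of_mem_of_not_mem hu hw)
  rw [Sym2.map_congr swap_eq, Sym2.map_id, id]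

variable {n : ℕ}

lemma pairProb_mk (p q : unitInterval) (σ : Labeling n) (a b : Fin n) :
    pairProb p q σ s(a, b) = if σ a = σ b then p else q := by
  simp [pairProb]

lemma pairProb_comp (p q : unitInterval) (σ : Labeling n) (τ : Equiv.Perm (Fin n))
    (e : Sym2 (Fin n)) : pairProb p q (σ ∘ τ) e = pairProb p q σ (e.map τ) := by
  simp [pairProb, Sym2.map_map]

lemma pairProb_comp_swap_of_notMem (p q : unitInterval) (σ : Labeling n) {v w : Fin n}
    {e : Sym2 (Fin n)} (hv : v ∉ e) (hw : w ∉ e) :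
    pairProb p q (σ ∘ Equiv.swap v w) e = pairProb p q σ e := by
  rw [pairProb_comp, map_swap_of_notMem hv hw]

/-- The vertex `v` is balanced with respect to a set `Z` of pairs if it forms no pair of `Z` with
a vertex of `H`, and exactly `k` pairs of `Z` with vertices of each community. -/
structure BalancedAt (Z : Finset (Sym2 (Fin n))) (H : Finset (Fin n)) (k : ℕ) (σ : Labeling n)
    (v : Fin n) : Prop where
  notMem : ∀ u ∈ H, s(v, u) ∉ Z
  card_eq : ∀ c, Finset.card {u | s(v, u) ∈ Z ∧ σ u = c} = k

variable {Z : Finset (Sym2 (Fin n))} {H : Finset (Fin n)} {k : ℕ} {σ : Labeling n} {v w : Fin n}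

-- The label of `v` itself only decides which of the two factors comes from which community.
lemma BalancedAt.prod_filter_mem (h : BalancedAt Z H k σ v) {σ' : Labeling n}
    (hσ' : ∀ u ∉ H, σ' u = σ u) (p q : unitInterval) (φ : unitInterval → ℝ) :
    ∏ e ∈ Z with v ∈ e, φ (pairProb p q σ' e) = (φ p * φ q) ^ k :=
  calc ∏ e ∈ Z with v ∈ e, φ (pairProb p q σ' e)
      = ∏ u with s(v, u) ∈ Z, φ (if σ' v = σ u then p else q) := by
        rw [prod_filter_mem_eq_prod_filter_mk]
        refine Finset.prod_congr rfl fun u hu => ?_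
        rw [pairProb_mk, hσ' u fun hH => h.notMem u hH (Finset.mem_filter.1 hu).2]
    _ = ∏ c, ∏ u with s(v, u) ∈ Z ∧ σ u = c, φ (if σ' v = c then p else q) := by
        simp only [← Finset.filter_filter]
        exact (Finset.prod_fiberwise' _ σ fun c => φ (if σ' v = c then p else q)).symm
    _ = (∏ c, φ (if σ' v = c then p else q)) ^ k := by
        simp only [Finset.prod_const, h.card_eq, Finset.prod_pow]
    _ = (φ p * φ q) ^ k := by
        rw [show (Finset.univ : Finset ℤˣ) = {1, -1} from rfl, Finset.prod_pair (by decide)]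
        rcases Int.units_eq_one_or (σ' v) with hv | hv <;> simp [hv, mul_comm]

lemma prod_pairProb_comp_swap (hvH : v ∈ H) (hwH : w ∈ H) (hvw : v ≠ w)
    (hv : BalancedAt Z H k σ v) (hw : BalancedAt Z H k σ w) (p q : unitInterval)
    (φ : unitInterval → ℝ) :
    ∏ e ∈ Z, φ (pairProb p q (σ ∘ Equiv.swap v w) e) = ∏ e ∈ Z, φ (pairProb p q σ e) := by
  have swap_eq : ∀ u ∉ H, (σ ∘ Equiv.swap v w) u = σ u := fun u hu => by
    rw [Function.comp_apply, Equiv.swap_apply_of_ne_of_ne]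
    exacts [fun h => hu (h ▸ hvH), fun h => hu (h ▸ hwH)]
  have filter_eq : {e ∈ Z | v ∉ e ∧ w ∈ e} = ({e ∈ Z | w ∈ e} : Finset _) := by
    refine Finset.filter_congr fun e he => and_iff_right_of_imp fun hwe hve => ?_
    rw [(Sym2.mem_and_mem_iff hvw).1 ⟨hve, hwe⟩] at he
    exact hv.notMem w hwH he
  have split : ∀ f : Sym2 (Fin n) → ℝ, ∏ e ∈ Z, f e = (∏ e ∈ Z with v ∈ e, f e) *
      ((∏ e ∈ Z with w ∈ e, f e) * ∏ e ∈ Z with v ∉ e ∧ w ∉ e, f e) := fun f => by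
    rw [← Finset.prod_filter_mul_prod_filter_not Z (v ∈ ·) f,
      ← Finset.prod_filter_mul_prod_filter_not {e ∈ Z | v ∉ e} (w ∈ ·) f,
      Finset.filter_filter, Finset.filter_filter, filter_eq]
  rw [split, split, hv.prod_filter_mem swap_eq, hw.prod_filter_mem swap_eq,
    hv.prod_filter_mem fun _ _ => rfl, hw.prod_filter_mem fun _ _ => rfl]
  congr 2
  refine Finset.prod_congr rfl fun e he => ?_
  rw [pairProb_comp_swap_of_notMem p q σ (Finset.mem_filter.1 he).2.1 (Finset.mem_filter.1 he).2.2]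

end Swap

/-! ### Marked and neutral pairs -/

/-- A choice of edge indicators that are called marked and of others that are called neutral. -/
structure Marking (κ : Type) where
  marked : Finset κ
  neutral : Finset κ
  disjoint : Disjoint marked neutral

section Marking

variable {ι κ : Type} [DecidableEq κ] {n : ℕ}

/-- The event that all coordinates in `S` are marked or neutral, and exactly `k` are marked. -/
def Marking.exactly (m : Marking κ) (S : Finset ι) (k : ℕ) : Set (ι → κ) :=
  {x | (∀ i ∈ S, x i ∈ m.marked ∪ m.neutral) ∧ Finset.card {i ∈ S | x i ∈ m.marked} = k}

/-- The vertices outside `H` that carry the label `c`. -/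
def outerClass (H : Finset (Fin n)) (σ : Labeling n) (c : ℤˣ) : Finset (Fin n) :=
  {u ∈ Hᶜ | σ u = c}

/-- The event that all pairs formed by `v` and a vertex of `H` are neutral. -/
def Marking.innerGood (m : Marking κ) (H : Finset (Fin n)) (v : Fin n) :
    Set (Sym2 (Fin n) → κ) :=
  {x | ∀ e ∈ star v H, x e ∈ m.neutral}

/-- The event that all pairs formed by `v` and a vertex outside `H` are marked or neutral, exactly
`k` being marked in each community. -/
def Marking.outerGood (m : Marking κ) (H : Finset (Fin n)) (k : ℕ) (σ : Labeling n) (v : Fin n) :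
    Set (Sym2 (Fin n) → κ) :=
  ⋂ c, m.exactly (star v (outerClass H σ c)) k

/-- The event that `v` is good, that is, surely balanced with respect to the marked pairs. -/
def Marking.good (m : Marking κ) (H : Finset (Fin n)) (k : ℕ) (σ : Labeling n) (v : Fin n) :
    Set (Sym2 (Fin n) → κ) :=
  m.outerGood H k σ v ∩ m.innerGood H v

variable {m : Marking κ} {H : Finset (Fin n)} {k : ℕ} {σ : Labeling n} {x : Sym2 (Fin n) → κ}
  {v : Fin n}

lemma Marking.apply_mem_neutral (h : x ∈ m.good H k σ v) {u : Fin n} (hu : u ∈ H) :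
    x s(v, u) ∈ m.neutral :=
  h.2 _ (Finset.mem_image_of_mem _ hu)

lemma Marking.apply_mem_union (h : x ∈ m.good H k σ v) (u : Fin n) :
    x s(v, u) ∈ m.marked ∪ m.neutral := by
  by_cases hu : u ∈ H
  · exact Finset.mem_union_right _ (Marking.apply_mem_neutral h hu)
  · exact (Set.mem_iInter.1 h.1 (σ u)).1 _ (Finset.mem_image_of_mem _ (by simp [outerClass, hu]))

lemma Marking.balancedAt (h : x ∈ m.good H k σ v) {Z : Finset (Sym2 (Fin n))}
    (hZ : ∀ u, s(v, u) ∈ Z ↔ x s(v, u) ∈ m.marked) : BalancedAt Z H k σ v := by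
  have notMem : ∀ u ∈ H, s(v, u) ∉ Z := fun u hu hmem =>
    Finset.disjoint_left.1 m.disjoint ((hZ u).1 hmem) (Marking.apply_mem_neutral h hu)
  refine ⟨notMem, fun c => ?_⟩
  rw [← (Set.mem_iInter.1 h.1 c).2, star, Finset.filter_image,
    Finset.card_image_of_injective _ (star_injective v)]
  congr 1
  ext u
  simp only [outerClass, Finset.mem_filter, Finset.mem_univ, true_and, Finset.mem_compl, hZ u]
  constructor
  · exact fun hu => ⟨⟨fun hH => notMem u hH ((hZ u).2 hu.1), hu.2⟩, hu.1⟩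
  · exact fun hu => ⟨hu.2, hu.1.2⟩

end Marking

/-! ### Likelihoods -/

section Likelihood

/-- The probability that a pair is an edge of neither of the two subsampled graphs. -/
noncomputable def noneWeight (r t : ℝ) : ℝ := 1 - r * (2 * t - t ^ 2)

/-- The probability mass function `pairLaw`, with real values. -/
noncomputable def pairWeight (r t : ℝ) : Bool × Bool → ℝ
  | (true, true) => r * t ^ 2
  | (true, false) => r * (t * (1 - t))
  | (false, true) => r * (t * (1 - t))
  | (false, false) => noneWeight r t

lemma noneWeight_pos {r t : ℝ} (hr : 0 ≤ r) (hr' : r < 1) : 0 < noneWeight r t := by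
  unfold noneWeight
  nlinarith [mul_nonneg hr (sq_nonneg (1 - t))]

lemma pairWeight_nonneg (r s : unitInterval) (y : Bool × Bool) : 0 ≤ pairWeight r s y := by
  have hr := r.2.1
  have hr' := r.2.2
  have hs := s.2.1
  have hs' : 0 ≤ 1 - (s : ℝ) := sub_nonneg.2 s.2.2
  rcases y with ⟨_ | _, _ | _⟩ <;> simp only [pairWeight, noneWeight]
  · nlinarith [mul_nonneg hs' hs', mul_nonneg hr (mul_nonneg hs' hs')]
  all_goals positivity

lemma bern_apply (p : unitInterval) (b : Bool) :
    bern p b = ENNReal.ofReal (if b then (p : ℝ) else 1 - p) := rfl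

lemma pairLaw_apply (r s : unitInterval) (y : Bool × Bool) :
    pairLaw r s y = ENNReal.ofReal (pairWeight r s y) := by
  have hr := r.2.1
  have hr' : 0 ≤ 1 - (r : ℝ) := sub_nonneg.2 r.2.2
  have hs := s.2.1
  have hs' : 0 ≤ 1 - (s : ℝ) := sub_nonneg.2 s.2.2
  have pairWeight_eq : pairWeight r s y = (if y = (false, false) then 1 - (r : ℝ) else 0) +
      r * ((if y.1 then (s : ℝ) else 1 - s) * if y.2 then (s : ℝ) else 1 - s) := by
    rcases y with ⟨_ | _, _ | _⟩ <;> simp only [pairWeight, noneWeight] <;> grind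
  rw [pairWeight_eq, ENNReal.ofReal_add (by positivity) (by positivity), ENNReal.ofReal_mul hr,
    ENNReal.ofReal_mul (by positivity), pairLaw, PMF.bind_apply, tsum_bool]
  rcases y with ⟨_ | _, _ | _⟩ <;> simp [bern_apply]

variable {n : ℕ}

lemma edgeLaw_apply (p q s : unitInterval) (σ : Labeling n) (x : Sym2 (Fin n) → Bool × Bool) :
    edgeLaw p q s σ x = ENNReal.ofReal (∏ e, pairWeight (pairProb p q σ e) s (x e)) := by
  rw [ENNReal.ofReal_prod_of_nonneg fun e _ => pairWeight_nonneg _ _ _]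
  simp only [edgeLaw, indep_apply, pairLaw_apply]

lemma labelLaw_comp (σ : Labeling n) (τ : Equiv.Perm (Fin n)) :
    labelLaw n (σ ∘ τ) = labelLaw n σ :=
  Equiv.prod_comp τ fun i => PMF.uniformOfFintype ℤˣ (σ i)

lemma configLaw_le_configLaw (p q s : unitInterval) {z z' : Config n} {τ : Equiv.Perm (Fin n)}
    (hlabels : z'.labels = z.labels ∘ τ)
    (h : edgeLaw p q s z.labels z.pairs ≤ edgeLaw p q s z'.labels z'.pairs) :
    configLaw n p q s z ≤ configLaw n p q s z' := by
  rw [configLaw_apply, configLaw_apply, hlabels, labelLaw_comp, ← hlabels]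
  gcongr

lemma prod_pairProb_comp (p q : unitInterval) (σ : Labeling n) (τ : Equiv.Perm (Fin n))
    (Z : Finset (Sym2 (Fin n))) (φ : unitInterval → ℝ) :
    ∏ e with e.map τ ∈ Z, φ (pairProb p q (σ ∘ τ) e) = ∏ e ∈ Z, φ (pairProb p q σ e) := by
  have map_bijective : Function.Bijective (Sym2.map τ : Sym2 (Fin n) → Sym2 (Fin n)) :=
    Finite.injective_iff_bijective.1 (Sym2.map.injective τ.injective)
  simp only [Finset.prod_filter, pairProb_comp]
  rw [map_bijective.prod_comp fun e => if e ∈ Z then φ (pairProb p q σ e) else 1,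
    Finset.prod_ite_mem, Finset.univ_inter]

lemma pairProb_lt_one {p q : unitInterval} (hp : (p : ℝ) < 1) (hq : (q : ℝ) < 1)
    (σ : Labeling n) (e : Sym2 (Fin n)) : (pairProb p q σ e : ℝ) < 1 := by
  unfold pairProb
  split_ifs <;> assumption

lemma pairProb_pos {p q : unitInterval} (hp : 0 < (p : ℝ)) (hq : 0 < (q : ℝ))
    (σ : Labeling n) (e : Sym2 (Fin n)) : 0 < (pairProb p q σ e : ℝ) := by
  unfold pairProb
  split_ifs <;> assumption

variable {p q s : unitInterval} {H : Finset (Fin n)} {k : ℕ} {σ : Labeling n}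
  {x : Sym2 (Fin n) → Bool × Bool} {v w : Fin n}

/-- The edges of the union of the two graphs are marked. -/
def unionMarking : Marking (Bool × Bool) where
  marked := {(true, true), (true, false), (false, true)}
  neutral := {(false, false)}
  disjoint := by decide

/-- The edges of the first graph are marked, and must not be edges of the second graph. -/
def firstMarking : Marking (Bool × Bool) where
  marked := {(true, false)}
  neutral := {(false, false), (false, true)}
  disjoint := by decide

lemma prod_pairWeight_eq_union (hp : (p : ℝ) < 1) (hq : (q : ℝ) < 1) (σ : Labeling n)
    (x : Sym2 (Fin n) → Bool × Bool) :
    ∏ e, pairWeight (pairProb p q σ e) s (x e) =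
      (∏ e : Sym2 (Fin n), noneWeight (pairProb p q σ e) s) *
      (∏ e with x e ∈ unionMarking.marked,
        (pairProb p q σ e : ℝ) / noneWeight (pairProb p q σ e) s) *
      ∏ e with x e ∈ unionMarking.marked, pairWeight 1 s (x e) := by
  simp only [Finset.prod_filter, ← Finset.prod_mul_distrib]
  refine Finset.prod_congr rfl fun e _ => ?_
  have hne : noneWeight (pairProb p q σ e) s ≠ 0 :=
    (noneWeight_pos (pairProb p q σ e).2.1 (pairProb_lt_one hp hq σ e)).ne'
  rcases x e with ⟨_ | _, _ | _⟩ <;> simp [pairWeight, unionMarking, mul_div_cancel₀, hne]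

lemma edgeLaw_comp_swap_of_union_good (hp : (p : ℝ) < 1) (hq : (q : ℝ) < 1) (s : unitInterval)
    (hvH : v ∈ H) (hwH : w ∈ H) (hvw : v ≠ w) (hv : x ∈ unionMarking.good H k σ v)
    (hw : x ∈ unionMarking.good H k σ w) :
    edgeLaw p q s (σ ∘ Equiv.swap v w) x = edgeLaw p q s σ x := by
  have noneWeight_comp := prod_pairProb_comp p q σ (Equiv.swap v w) Finset.univ
    fun r => noneWeight r s
  simp only [Finset.mem_univ, Finset.filter_true] at noneWeight_comp
  rw [edgeLaw_apply, edgeLaw_apply, prod_pairWeight_eq_union hp hq,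
    prod_pairWeight_eq_union hp hq, noneWeight_comp,
    prod_pairProb_comp_swap hvH hwH hvw (Marking.balancedAt hv (by simp))
      (Marking.balancedAt hw (by simp)) p q fun r => (r : ℝ) / noneWeight r s]

/-- The odds of a pair being an edge of one given graph only, against no graph. -/
noncomputable def singleOdds (r t : ℝ) : ℝ := r * (t * (1 - t)) / noneWeight r t

/-- The factor by which a common edge is more likely than `singleOdds` would predict if the two
graphs were independent. -/
noncomputable def commonRatio (r t : ℝ) : ℝ := noneWeight r t / (r * (1 - t) ^ 2)

lemma singleOdds_nonneg (r s : unitInterval) (hr : (r : ℝ) < 1) : 0 ≤ singleOdds r s := by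
  have := (noneWeight_pos (t := s) r.2.1 hr).le
  have := sub_nonneg.2 s.2.2
  have := r.2.1
  have := s.2.1
  unfold singleOdds
  positivity

lemma one_le_commonRatio {r t : ℝ} (hr : 0 < r) (hr' : r < 1) (ht : t < 1) :
    1 ≤ commonRatio r t := by
  have : 0 < 1 - t := sub_pos.2 ht
  unfold commonRatio noneWeight
  rw [le_div_iff₀ (by positivity)]
  nlinarith

lemma prod_pairWeight_eq_first (hp₀ : 0 < (p : ℝ)) (hp : (p : ℝ) < 1) (hq₀ : 0 < (q : ℝ))
    (hq : (q : ℝ) < 1) (hs : (s : ℝ) < 1) (σ : Labeling n) (x : Sym2 (Fin n) → Bool × Bool) :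
    ∏ e, pairWeight (pairProb p q σ e) s (x e) =
      (∏ e : Sym2 (Fin n), noneWeight (pairProb p q σ e) s) *
      (∏ e with (x e).1 = true, singleOdds (pairProb p q σ e) s) *
      (∏ e with (x e).2 = true, singleOdds (pairProb p q σ e) s) *
      ∏ e with (x e).1 = true ∧ (x e).2 = true, commonRatio (pairProb p q σ e) s := by
  simp only [Finset.prod_filter, ← Finset.prod_mul_distrib]
  refine Finset.prod_congr rfl fun e _ => ?_
  have hr : (pairProb p q σ e : ℝ) ≠ 0 := (pairProb_pos hp₀ hq₀ σ e).ne'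
  have hne : noneWeight (pairProb p q σ e) s ≠ 0 :=
    (noneWeight_pos (pairProb p q σ e).2.1 (pairProb_lt_one hp hq σ e)).ne'
  have hs' : 1 - (s : ℝ) ≠ 0 := (sub_pos.2 hs).ne'
  rcases x e with ⟨_ | _, _ | _⟩ <;> simp [pairWeight, singleOdds, commonRatio] <;> field_simp

lemma notMem_of_first_good (h : x ∈ firstMarking.good H k σ v) {e : Sym2 (Fin n)}
    (he : (x e).1 = true ∧ (x e).2 = true) : v ∉ e := fun hv => by
  obtain ⟨u, rfl⟩ := Sym2.mem_iff_exists.1 hv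
  have hmem := Marking.apply_mem_union h u
  rw [Prod.ext (x := x s(v, u)) (y := (true, true)) he.1 he.2] at hmem
  exact absurd hmem (by decide)

lemma balancedAt_of_first_good (h : x ∈ firstMarking.good H k σ v) :
    BalancedAt {e | (x e).1 = true} H k σ v := by
  have fst_iff : ∀ y ∈ firstMarking.marked ∪ firstMarking.neutral,
      y.1 = true ↔ y ∈ firstMarking.marked := by decide
  exact Marking.balancedAt h fun u => by simpa using fst_iff _ (Marking.apply_mem_union h u)

-- The exchange leaves the common edges common, since they avoid `v` and `w`. It may create
-- further common edges, but these only increase the likelihood.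
lemma prod_commonRatio_le_of_first_good (hp₀ : 0 < (p : ℝ)) (hp : (p : ℝ) < 1)
    (hq₀ : 0 < (q : ℝ)) (hq : (q : ℝ) < 1) (hs : (s : ℝ) < 1)
    (hv : x ∈ firstMarking.good H k σ v) (hw : x ∈ firstMarking.good H k σ w) :
    ∏ e with (x e).1 = true ∧ (x e).2 = true, commonRatio (pairProb p q σ e) s ≤
      ∏ e with (x e).1 = true ∧ (x (e.map (Equiv.swap v w))).2 = true,
        commonRatio (pairProb p q (σ ∘ Equiv.swap v w) e) s := by
  have one_le : ∀ e : Sym2 (Fin n),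
      1 ≤ commonRatio (pairProb p q (σ ∘ Equiv.swap v w) e) s := fun e =>
    one_le_commonRatio (pairProb_pos hp₀ hq₀ _ e) (pairProb_lt_one hp hq _ e) hs
  calc ∏ e with (x e).1 = true ∧ (x e).2 = true, commonRatio (pairProb p q σ e) s
      = ∏ e with (x e).1 = true ∧ (x e).2 = true,
          commonRatio (pairProb p q (σ ∘ Equiv.swap v w) e) s := by
        refine Finset.prod_congr rfl fun e he => ?_
        have he := (Finset.mem_filter.1 he).2
        rw [pairProb_comp_swap_of_notMem p q σ (notMem_of_first_good hv he)
          (notMem_of_first_good hw he)]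
    _ ≤ _ := by
        refine Finset.prod_le_prod_of_subset_of_one_le (fun e he => ?_)
          (fun e _ => zero_le_one.trans (one_le e)) fun e _ _ => one_le e
        have he := (Finset.mem_filter.1 he).2
        rw [Finset.mem_filter, map_swap_of_notMem (notMem_of_first_good hv he)
          (notMem_of_first_good hw he)]
        exact ⟨Finset.mem_univ e, he⟩

lemma edgeLaw_le_of_first_good (hp₀ : 0 < (p : ℝ)) (hp : (p : ℝ) < 1) (hq₀ : 0 < (q : ℝ))
    (hq : (q : ℝ) < 1) (hs : (s : ℝ) < 1) (hvH : v ∈ H) (hwH : w ∈ H) (hvw : v ≠ w)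
    (hv : x ∈ firstMarking.good H k σ v) (hw : x ∈ firstMarking.good H k σ w) :
    edgeLaw p q s σ x ≤ edgeLaw p q s (σ ∘ Equiv.swap v w)
      (fun e => ((x e).1, (x (e.map (Equiv.swap v w))).2)) := by
  have noneWeight_comp := prod_pairProb_comp p q σ (Equiv.swap v w) Finset.univ
    fun r => noneWeight r s
  have second_comp := prod_pairProb_comp p q σ (Equiv.swap v w) {e | (x e).2 = true}
    fun r => singleOdds r s
  simp only [Finset.mem_univ, Finset.filter_true, Finset.mem_filter, true_and]
    at noneWeight_comp second_comp
  rw [edgeLaw_apply, edgeLaw_apply]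
  refine ENNReal.ofReal_le_ofReal ?_
  rw [prod_pairWeight_eq_first hp₀ hp hq₀ hq hs, prod_pairWeight_eq_first hp₀ hp hq₀ hq hs,
    noneWeight_comp, second_comp, prod_pairProb_comp_swap hvH hwH hvw
      (balancedAt_of_first_good hv) (balancedAt_of_first_good hw) p q fun r => singleOdds r s]
  have odds_nonneg : ∀ e, 0 ≤ singleOdds (pairProb p q σ e) s := fun e =>
    singleOdds_nonneg _ s (pairProb_lt_one hp hq σ e)
  refine mul_le_mul_of_nonneg_left
    (prod_commonRatio_le_of_first_good hp₀ hp hq₀ hq hs hv hw) ?_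
  exact mul_nonneg (mul_nonneg
    (Finset.prod_nonneg fun e _ => pairWeight_nonneg (pairProb p q σ e) s (false, false))
    (Finset.prod_nonneg fun e _ => odds_nonneg e)) (Finset.prod_nonneg fun e _ => odds_nonneg e)

end Likelihood

/-! ### Events depending on disjoint sets of coordinates -/

section DisjointCoordinates

open MeasureTheory ProbabilityTheory

variable {ι κ V : Type}

lemma dependsOn_compl {A : Set (ι → κ)} {S : Set ι} (hA : DependsOn (· ∈ A) S) :
    DependsOn (· ∈ Aᶜ) S :=
  fun _ _ h => congrArg Not (hA h)

lemma dependsOn_biInter [DecidableEq ι] {A : V → Set (ι → κ)} {S : V → Finset ι} {B : Finset V}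
    (hA : ∀ v ∈ B, DependsOn (· ∈ A v) (S v : Set ι)) :
    DependsOn (· ∈ ⋂ v ∈ B, A v) (B.biUnion S : Set ι) := fun x y h => by
  simp only [Set.mem_iInter]
  exact propext (forall₂_congr fun v hv => iff_of_eq (hA v hv fun i hi =>
    h i (Finset.mem_coe.2 (Finset.mem_biUnion.2 ⟨v, hv, hi⟩))))

variable [Fintype ι] [Finite κ] [MeasurableSpace κ] [MeasurableSingletonClass κ]
  (ν : ι → Measure κ) [∀ i, IsProbabilityMeasure (ν i)]

lemma measure_pi_inter {A B : Set (ι → κ)} {S T : Finset ι} (hST : Disjoint S T)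
    (hA : DependsOn (· ∈ A) (S : Set ι)) (hB : DependsOn (· ∈ B) (T : Set ι)) :
    Measure.pi ν (A ∩ B) = Measure.pi ν A * Measure.pi ν B := by
  have indep_restrict :=
    (iIndepFun_pi (μ := ν) (X := fun _ => id) fun _ => aemeasurable_id).indepFun_finset S T hST
      fun i => measurable_pi_apply i
  have eq_preimage {A : Set (ι → κ)} {S : Finset ι} (hA : DependsOn (· ∈ A) (S : Set ι)) :
      A = (fun (x : ι → κ) (i : S) => id (x i)) ⁻¹'
        ((fun (x : ι → κ) (i : S) => id (x i)) '' A) := by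
    refine (Set.subset_preimage_image _ _).antisymm ?_
    rintro x ⟨y, hy, hyx⟩
    exact (hA (x := y) (y := x) fun i hi => congrFun hyx ⟨i, hi⟩).mp hy
  rw [eq_preimage hA, eq_preimage hB]
  exact indep_restrict.measure_inter_preimage_eq_mul _ _ (Set.toFinite _).measurableSet
    (Set.toFinite _).measurableSet

lemma measure_pi_biInter {A : V → Set (ι → κ)}
    {S : V → Finset ι} {B : Finset V} (hS : (B : Set V).PairwiseDisjoint S)
    (hA : ∀ v ∈ B, DependsOn (· ∈ A v) (S v : Set ι)) :
    Measure.pi ν (⋂ v ∈ B, A v) = ∏ v ∈ B, Measure.pi ν (A v) := by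
  classical
  induction B using Finset.induction_on with
  | empty => simp
  | insert a B ha ih =>
    have disjoint_rest : Disjoint (S a) (B.biUnion S) := by
      rw [Finset.disjoint_biUnion_right]
      exact fun v hv => hS (by simp) (by simp [hv]) fun h => ha (h ▸ hv)
    have hB : ∀ v ∈ B, DependsOn (· ∈ A v) (S v : Set ι) := fun v hv =>
      hA v (Finset.mem_insert_of_mem hv)
    rw [Finset.set_biInter_insert, measure_pi_inter ν disjoint_rest (hA a (by simp))
      (dependsOn_biInter hB), ih (hS.subset (by simp)) hB, Finset.prod_insert ha]

lemma measure_pi_forall_notMem_le {E : V → Set (ι → κ)}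
    {S : V → Finset ι} {B : Finset V} (hS : (B : Set V).PairwiseDisjoint S)
    (hE : ∀ v ∈ B, DependsOn (· ∈ E v) (S v : Set ι)) {c : ENNReal}
    (hc : ∀ v ∈ B, c ≤ Measure.pi ν (E v)) :
    Measure.pi ν {x | ∀ v ∈ B, x ∉ E v} ≤ (1 - c) ^ B.card := by
  have eq_biInter : {x | ∀ v ∈ B, x ∉ E v} = ⋂ v ∈ B, (E v)ᶜ := by
    ext
    simp
  rw [eq_biInter, measure_pi_biInter ν hS fun v hv => dependsOn_compl (hE v hv)]
  refine Finset.prod_le_pow_card _ _ _ fun v hv => ?_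
  rw [prob_compl_eq_one_sub (Set.toFinite _).measurableSet]
  exact tsub_le_tsub_left (hc v hv) _

-- An event selected by independent randomness is no more likely to fail than the worst one.
lemma measure_pi_notMem_select_le [Finite V] {f : (ι → κ) → V} {F : V → Set (ι → κ)}
    {S T : Finset ι} (hST : Disjoint S T) (hf : DependsOn f (S : Set ι))
    (hF : ∀ v, DependsOn (· ∈ F v) (T : Set ι)) {ε : ENNReal}
    (hε : ∀ v, Measure.pi ν (F v)ᶜ ≤ ε) :
    Measure.pi ν {x | x ∉ F (f x)} ≤ ε := by
  have := Fintype.ofFinite V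
  have subset_iUnion : {x | x ∉ F (f x)} ⊆ ⋃ v, f ⁻¹' {v} ∩ (F v)ᶜ := fun x hx =>
    Set.mem_iUnion.2 ⟨f x, rfl, hx⟩
  have dependsOn_fiber : ∀ v, DependsOn (· ∈ f ⁻¹' {v}) (S : Set ι) := fun v _ _ h =>
    congrArg (· = v) (hf h)
  calc Measure.pi ν {x | x ∉ F (f x)}
      ≤ ∑ v, Measure.pi ν (f ⁻¹' {v} ∩ (F v)ᶜ) :=
        (measure_mono subset_iUnion).trans (measure_iUnion_fintype_le _ _)
    _ = ∑ v, Measure.pi ν (f ⁻¹' {v}) * Measure.pi ν (F v)ᶜ :=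
        Finset.sum_congr rfl fun v _ =>
          measure_pi_inter ν hST (dependsOn_fiber v) (dependsOn_compl (hF v))
    _ ≤ (∑ v, Measure.pi ν (f ⁻¹' {v})) * ε := by
        rw [Finset.sum_mul]
        gcongr with v
        exact hε v
    _ = ε := by
        rw [sum_measure_preimage_singleton _ fun v _ => (Set.toFinite _).measurableSet]
        simp

lemma measure_pi_forall_notMem_inter_le [DecidableEq ι] {E F : V → Set (ι → κ)}
    {S : V → Finset ι} {T : Finset ι} {B : Finset V} (hS : (B : Set V).PairwiseDisjoint S)
    (hST : Disjoint (B.biUnion S) T) (hE : ∀ v ∈ B, DependsOn (· ∈ E v) (S v : Set ι))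
    (hF : ∀ v ∈ B, DependsOn (· ∈ F v) (T : Set ι)) {c ε : ENNReal}
    (hc : ∀ v ∈ B, c ≤ Measure.pi ν (E v)) (hε : ∀ v ∈ B, Measure.pi ν (F v)ᶜ ≤ ε) :
    Measure.pi ν {x | ∀ v ∈ B, x ∉ E v ∩ F v} ≤ (1 - c) ^ B.card + ε := by
  rcases B.eq_empty_or_nonempty with rfl | ⟨v₀, hv₀⟩
  · simp
  have : Nonempty B := ⟨⟨v₀, hv₀⟩⟩
  let select : (ι → κ) → B := fun x => Classical.epsilon fun v => x ∈ E v
  have dependsOn_select : DependsOn select (B.biUnion S : Set ι) := fun x y h =>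
    congrArg Classical.epsilon (funext fun v => hE v v.2 fun i hi =>
      h i (Finset.mem_coe.2 (Finset.mem_biUnion.2 ⟨v, v.2, hi⟩)))
  have subset_union : {x | ∀ v ∈ B, x ∉ E v ∩ F v} ⊆
      {x | ∀ v ∈ B, x ∉ E v} ∪ {x | x ∉ F (select x)} := fun x hx => by
    refine or_iff_not_imp_left.2 fun hE' hF' => hx (select x) (select x).2 ⟨?_, hF'⟩
    simp only [Set.mem_ofPred_eq, not_forall, not_not] at hE'
    obtain ⟨v, hv, hxv⟩ := hE'
    exact Classical.epsilon_spec (p := fun v : B => x ∈ E v) ⟨⟨v, hv⟩, hxv⟩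
  refine (measure_mono subset_union).trans ((measure_union_le _ _).trans ?_)
  exact add_le_add (measure_pi_forall_notMem_le ν hS hE hc)
    (measure_pi_notMem_select_le ν hST dependsOn_select (fun v => hF v v.2) fun v => hε v v.2)

end DisjointCoordinates

/-! ### Concentration of the labels -/

section Labels

open MeasureTheory ProbabilityTheory

variable {n : ℕ}

/-- The sum of the labels in `S`. -/
def labelSum (S : Finset (Fin n)) (σ : Labeling n) : ℝ := ∑ i ∈ S, ((σ i : ℤ) : ℝ)

lemma integral_uniformOfFintype_units [MeasurableSpace ℤˣ] [MeasurableSingletonClass ℤˣ] :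
    ∫ u : ℤˣ, ((u : ℤ) : ℝ) ∂(PMF.uniformOfFintype ℤˣ).toMeasure = 0 := by
  simp [PMF.integral_eq_sum, PMF.uniformOfFintype_apply,
    show (Finset.univ : Finset ℤˣ) = {1, -1} by decide]

lemma variance_intCast_units_le [MeasurableSpace ℤˣ] [MeasurableSingletonClass ℤˣ]
    (μ : Measure ℤˣ) [IsProbabilityMeasure μ] : Var[fun u : ℤˣ => ((u : ℤ) : ℝ); μ] ≤ 1 := by
  have bounded : ∀ u : ℤˣ, ((u : ℤ) : ℝ) ∈ Set.Icc (-1) 1 := fun u => by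
    rcases Int.units_eq_one_or u with rfl | rfl <;> simp
  refine (variance_le_sq_of_bounded (.of_forall bounded)
    Measurable.of_discrete.aemeasurable).trans_eq ?_
  norm_num

lemma labelLaw_chebyshev {S : Finset (Fin n)} (hS : S.Nonempty) {δ : ℝ} (hδ : 0 < δ) :
    (labelLaw n).toOuterMeasure {σ | δ * S.card ≤ |labelSum S σ|} ≤
      ENNReal.ofReal (1 / (δ ^ 2 * S.card)) := by
  let : MeasurableSpace ℤˣ := ⊤
  have card_pos : (0 : ℝ) < S.card := by exact_mod_cast hS.card_pos
  let X : Fin n → ℤˣ → ℝ := fun i u => if i ∈ S then ((u : ℤ) : ℝ) else 0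
  have labelSum_eq : labelSum S = ∑ i, fun σ : Labeling n => X i (σ i) := by
    ext σ
    simp only [labelSum, X, Finset.sum_apply, Finset.sum_ite_mem, Finset.univ_inter]
  let μ : Measure (Labeling n) := .pi fun _ : Fin n => (PMF.uniformOfFintype ℤˣ).toMeasure
  have integral_eq : ∫ σ, labelSum S σ ∂μ = 0 := by
    unfold labelSum
    rw [integral_finsetSum _ fun i _ => Integrable.of_finite]
    refine Finset.sum_eq_zero fun i _ => ?_
    rw [integral_comp_eval (X := fun _ => ℤˣ) (f := fun u : ℤˣ => ((u : ℤ) : ℝ))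
      (Measurable.of_discrete).aestronglyMeasurable, integral_uniformOfFintype_units]
  have variance_le : Var[labelSum S; μ] ≤ S.card := by
    have variance_X : ∀ i, Var[X i; (PMF.uniformOfFintype ℤˣ).toMeasure] ≤
        if i ∈ S then 1 else 0 := fun i => by
      by_cases hi : i ∈ S
      · simpa only [X, hi, if_true] using variance_intCast_units_le _
      · simp only [X, hi, if_false]
        exact (variance_zero _).le
    rw [labelSum_eq, variance_sum_pi fun i => MemLp.of_discrete]
    exact (Finset.sum_le_sum fun i _ => variance_X i).trans (by simp)
  rw [← PMF.toMeasure_apply_eq_toOuterMeasure, labelLaw, toMeasure_indep]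
  have := meas_ge_le_variance_div_sq (μ := μ) (X := labelSum S) MemLp.of_discrete
    (mul_pos hδ card_pos)
  simp only [integral_eq, sub_zero] at this
  refine this.trans (ENNReal.ofReal_le_ofReal ?_)
  calc Var[labelSum S; μ] / (δ * S.card) ^ 2 ≤ S.card / (δ * S.card) ^ 2 := by gcongr
    _ = 1 / (δ ^ 2 * S.card) := by field_simp

lemma card_filter_label_eq (S : Finset (Fin n)) (σ : Labeling n) (c : ℤˣ) :
    (Finset.card {v ∈ S | σ v = c} : ℝ) = (S.card + ((c : ℤ) : ℝ) * labelSum S σ) / 2 := by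
  have indicator_eq : ∀ v, (if σ v = c then (1 : ℝ) else 0) =
      (1 + ((c : ℤ) : ℝ) * ((σ v : ℤ) : ℝ)) / 2 := fun v => by
    rcases Int.units_eq_one_or (σ v) with h | h <;>
      rcases Int.units_eq_one_or c with hc | hc <;> rw [h, hc] <;> norm_num
  simp only [Finset.card_filter, Nat.cast_sum, Nat.cast_ite, Nat.cast_one, Nat.cast_zero,
    indicator_eq, labelSum]
  rw [← Finset.sum_div, Finset.sum_add_distrib, Finset.mul_sum, Finset.sum_const, nsmul_one]

lemma abs_card_filter_label_sub_le {S : Finset (Fin n)} {σ : Labeling n} {a : ℝ}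
    (h : |labelSum S σ| ≤ a) (c : ℤˣ) :
    |(Finset.card {v ∈ S | σ v = c} : ℝ) - S.card / 2| ≤ a / 2 := by
  have abs_c : |((c : ℤ) : ℝ)| = 1 := by
    rcases Int.units_eq_one_or c with rfl | rfl <;> simp
  calc |(Finset.card {v ∈ S | σ v = c} : ℝ) - S.card / 2|
      = |((c : ℤ) : ℝ) * labelSum S σ / 2| := by
        rw [card_filter_label_eq]
        ring_nf
    _ ≤ a / 2 := by
        rw [abs_div, abs_mul, abs_c, one_mul, abs_two]
        gcongr

end Labels

/-! ### Probability of good vertices -/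

section Exactly

open MeasureTheory

variable {ι κ : Type}

/-- The event that the coordinates in `A` are marked and the other coordinates in `S` neutral. -/
def Marking.pattern [DecidableEq ι] (m : Marking κ) (S A : Finset ι) : Set (ι → κ) :=
  (S : Set ι).pi fun i => ((if i ∈ A then m.marked else m.neutral : Finset κ) : Set κ)

lemma Marking.filter_marked_eq_of_mem_pattern [DecidableEq ι] [DecidableEq κ] {m : Marking κ}
    {S A : Finset ι} (hA : A ⊆ S) {x : ι → κ} (hx : x ∈ m.pattern S A) :
    {i ∈ S | x i ∈ m.marked} = A := by
  have apply_mem : ∀ i ∈ S, x i ∈ if i ∈ A then m.marked else m.neutral := hx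
  ext i
  rw [Finset.mem_filter]
  refine ⟨fun ⟨hi, hmarked⟩ => ?_, fun hi => ⟨hA hi, ?_⟩⟩
  · by_contra hiA
    have hneutral := apply_mem i hi
    rw [if_neg hiA] at hneutral
    exact Finset.disjoint_left.1 m.disjoint hmarked hneutral
  · have hmarked := apply_mem i (hA hi)
    rwa [if_pos hi] at hmarked

lemma Marking.exactly_eq_biUnion_pattern [DecidableEq ι] [DecidableEq κ] (m : Marking κ)
    (S : Finset ι) (k : ℕ) : m.exactly S k = ⋃ A ∈ S.powersetCard k, m.pattern S A := by
  ext x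
  simp only [Set.mem_iUnion, Finset.mem_powersetCard, exists_prop]
  constructor
  · rintro ⟨hx, hcard⟩
    refine ⟨{i ∈ S | x i ∈ m.marked}, ⟨Finset.filter_subset _ _, hcard⟩, fun i hi => ?_⟩
    rw [Finset.mem_coe] at hi ⊢
    split_ifs with hmarked
    · exact (Finset.mem_filter.1 hmarked).2
    · exact (Finset.mem_union.1 (hx i hi)).resolve_left fun h =>
        hmarked (Finset.mem_filter.2 ⟨hi, h⟩)
  · rintro ⟨A, ⟨hA, hcard⟩, hx⟩
    refine ⟨fun i hi => ?_, by rw [filter_marked_eq_of_mem_pattern hA hx, hcard]⟩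
    have hxi : x i ∈ if i ∈ A then m.marked else m.neutral := hx i hi
    split_ifs at hxi
    exacts [Finset.mem_union_left _ hxi, Finset.mem_union_right _ hxi]

lemma Marking.pairwiseDisjoint_pattern [DecidableEq ι] (m : Marking κ) (S : Finset ι) (k : ℕ) :
    (S.powersetCard k : Set (Finset ι)).PairwiseDisjoint (m.pattern S) := by
  classical
  exact fun _ hA _ hA' hne => Set.disjoint_left.2 fun _ hx hx' => hne <|
    (filter_marked_eq_of_mem_pattern (Finset.mem_powersetCard.1 hA).1 hx).symm.trans
      (filter_marked_eq_of_mem_pattern (Finset.mem_powersetCard.1 hA').1 hx')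

lemma Marking.measure_exactly [Fintype ι] [DecidableEq κ] [Finite κ] [MeasurableSpace κ]
    [MeasurableSingletonClass κ] (m : Marking κ) (ν : ι → Measure κ)
    [∀ i, IsProbabilityMeasure (ν i)] (S : Finset ι) (k : ℕ) {a b : ENNReal}
    (hmarked : ∀ i ∈ S, ν i m.marked = a) (hneutral : ∀ i ∈ S, ν i m.neutral = b) :
    Measure.pi ν (m.exactly S k) = S.card.choose k * a ^ k * b ^ (S.card - k) := by
  classical
  have measure_pattern : ∀ A ∈ S.powersetCard k,
      Measure.pi ν (m.pattern S A) = a ^ k * b ^ (S.card - k) := fun A hA => by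
    obtain ⟨hAS, hcard⟩ := Finset.mem_powersetCard.1 hA
    have measure_marked : ∀ i ∈ A, ν i (if i ∈ A then m.marked else m.neutral : Finset κ) = a :=
      fun i hi => by rw [if_pos hi, hmarked i (hAS hi)]
    have measure_neutral :
        ∀ i ∈ S \ A, ν i (if i ∈ A then m.marked else m.neutral : Finset κ) = b := fun i hi => by
      rw [if_neg (Finset.mem_sdiff.1 hi).2, hneutral i (Finset.mem_sdiff.1 hi).1]
    rw [pattern, Measure.pi_pi_finset, ← Finset.prod_sdiff hAS,
      Finset.prod_congr rfl measure_neutral, Finset.prod_congr rfl measure_marked,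
      Finset.prod_const, Finset.prod_const, Finset.card_sdiff_of_subset hAS, hcard, mul_comm]
  rw [exactly_eq_biUnion_pattern, measure_biUnion_finset (m.pairwiseDisjoint_pattern S k)
    fun A _ => (Set.toFinite _).measurableSet, Finset.sum_congr rfl measure_pattern,
    Finset.sum_const, Finset.card_powersetCard, nsmul_eq_mul, mul_assoc]

end Exactly

section Rates

open MeasureTheory

/-- The probability that exactly `k` of `h` independent coordinates are marked and the others are
neutral, if a coordinate is marked with probability `x` and not neutral with probability `y`. -/
noncomputable def binomialWeight (x y : ℝ) (h k : ℕ) : ℝ :=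
  h.choose k * x ^ k * (1 - y) ^ (h - k)

/-- A pair that is an edge of the parent graph with probability `r`, and is subsampled with
probability `s`, is marked with probability `r * a` and not neutral with probability `r * b`. -/
structure Marking.HasRates (m : Marking (Bool × Bool)) (s : unitInterval) (a b : ℝ) : Prop where
  sum_marked : ∀ r : unitInterval, ∑ y ∈ m.marked, pairWeight r s y = r * a
  sum_neutral : ∀ r : unitInterval, ∑ y ∈ m.neutral, pairWeight r s y = 1 - r * b

variable {m : Marking (Bool × Bool)} {s : unitInterval} {a b : ℝ}

lemma toMeasure_pairLaw (r s : unitInterval) (M : Finset (Bool × Bool)) :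
    (pairLaw r s).toMeasure M = ENNReal.ofReal (∑ y ∈ M, pairWeight r s y) := by
  rw [PMF.toMeasure_apply_finset, ENNReal.ofReal_sum_of_nonneg fun y _ => pairWeight_nonneg _ _ _]
  simp only [pairLaw_apply]

lemma Marking.HasRates.nonneg_marked (h : m.HasRates s a b) : 0 ≤ a := by
  have := h.sum_marked 1 ▸ Finset.sum_nonneg fun y _ => pairWeight_nonneg 1 s y
  simpa using this

lemma Marking.HasRates.le_one (h : m.HasRates s a b) : b ≤ 1 := by
  have := h.sum_neutral 1 ▸ Finset.sum_nonneg fun y _ => pairWeight_nonneg 1 s y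
  simpa using this

lemma Marking.HasRates.nonneg_unneutral (h : m.HasRates s a b) : 0 ≤ b := by
  have sum_univ : ∑ y, pairWeight 1 s y = 1 := by
    simp only [Fintype.sum_prod_type, Fintype.sum_bool, pairWeight, noneWeight]
    ring
  have sum_neutral := h.sum_neutral 1
  have := Finset.sum_le_univ_sum_of_nonneg (s := m.neutral) (pairWeight_nonneg 1 s)
  simp only [Set.Icc.coe_one, one_mul] at sum_neutral this
  linarith

lemma Marking.HasRates.toMeasure_compl_neutral_le (h : m.HasRates s a b) (r : unitInterval) :
    (pairLaw r s).toMeasure (m.neutral : Set (Bool × Bool))ᶜ ≤ ENNReal.ofReal r := by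
  have := mul_le_of_le_one_right r.2.1 h.le_one
  rw [prob_compl_eq_one_sub (Set.toFinite _).measurableSet, toMeasure_pairLaw, h.sum_neutral,
    ← ENNReal.ofReal_one, ← ENNReal.ofReal_sub _ (by linarith [r.2.2])]
  exact ENNReal.ofReal_le_ofReal (by linarith)

variable {n : ℕ} {κ : Type}

lemma disjoint_star_outerClass (H : Finset (Fin n)) (σ : Labeling n) (v : Fin n) :
    Pairwise fun c c' => Disjoint (star v (outerClass H σ c)) (star v (outerClass H σ c')) := by
  intro c c' hne
  rw [star, star, Finset.disjoint_image (star_injective v)]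
  refine Finset.disjoint_left.2 fun u hu hu' => hne ?_
  exact (Finset.mem_filter.1 hu).2.symm.trans (Finset.mem_filter.1 hu').2

lemma Marking.dependsOn_exactly {ι : Type} [DecidableEq κ] (m : Marking κ) (S : Finset ι) (k : ℕ) :
    DependsOn (· ∈ (m.exactly S k : Set (ι → κ))) (S : Set ι) := fun x y h => by
  refine congrArg₂ And (propext (forall₂_congr fun i hi => by rw [h i hi])) ?_
  rw [Finset.filter_congr fun i hi => by rw [h i hi]]

lemma Marking.dependsOn_outerGood [DecidableEq κ] (m : Marking κ) (H : Finset (Fin n)) (k : ℕ)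
    (σ : Labeling n) (v : Fin n) :
    DependsOn (· ∈ m.outerGood H k σ v) (star v Hᶜ : Set (Sym2 (Fin n))) := by
  simp only [outerGood, Set.mem_iInter]
  refine fun x y h => propext (forall_congr' fun c => ?_)
  refine iff_of_eq (m.dependsOn_exactly _ k fun e he => h e ?_)
  exact Finset.image_subset_image (Finset.filter_subset _ _) he

lemma Marking.dependsOn_innerGood (m : Marking κ) {H : Finset (Fin n)} {v : Fin n} (hv : v ∈ H) :
    DependsOn (· ∈ m.innerGood H v) (H.sym2 : Set (Sym2 (Fin n))) := fun x y h => by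
  refine propext (forall₂_congr fun e he => ?_)
  obtain ⟨u, hu, rfl⟩ := Finset.mem_image.1 he
  rw [h _ (Finset.mem_coe.2 (Finset.mk_mem_sym2_iff.2 ⟨hv, hu⟩))]

lemma pairwiseDisjoint_star_compl (H : Finset (Fin n)) :
    (H : Set (Fin n)).PairwiseDisjoint fun v => star v Hᶜ := by
  intro v _ w hw hne
  refine Finset.disjoint_left.2 fun e he he' => ?_
  obtain ⟨u, hu, rfl⟩ := Finset.mem_image.1 he
  obtain ⟨u', -, h⟩ := Finset.mem_image.1 he'
  rcases Sym2.eq_iff.1 h with ⟨h, -⟩ | ⟨h, -⟩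
  exacts [hne h.symm, Finset.mem_compl.1 hu (h ▸ hw)]

lemma disjoint_star_compl_sym2 (H B : Finset (Fin n)) :
    Disjoint (B.biUnion fun v => star v Hᶜ) H.sym2 := by
  refine Finset.disjoint_left.2 fun e he he' => ?_
  obtain ⟨v, -, he⟩ := Finset.mem_biUnion.1 he
  obtain ⟨u, hu, rfl⟩ := Finset.mem_image.1 he
  exact Finset.mem_compl.1 hu (Finset.mk_mem_sym2_iff.1 he').2

end Rates

section GoodVertices

open MeasureTheory

variable {m : Marking (Bool × Bool)} {p q s : unitInterval} {a b : ℝ} {n : ℕ}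
  {H : Finset (Fin n)} {k : ℕ} {σ : Labeling n}

lemma Marking.HasRates.mul_le_one (h : m.HasRates s a b) (r : unitInterval) : r * b ≤ 1 :=
  (mul_le_of_le_one_right r.2.1 h.le_one).trans r.2.2

lemma binomialWeight_nonneg {x y : ℝ} (hx : 0 ≤ x) (hy : y ≤ 1) (h k : ℕ) :
    0 ≤ binomialWeight x y h k := by
  have := sub_nonneg.2 hy
  unfold binomialWeight
  positivity

lemma ofReal_binomialWeight {x y : ℝ} (hx : 0 ≤ x) (hy : y ≤ 1) (h k : ℕ) :
    ENNReal.ofReal (binomialWeight x y h k) =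
      h.choose k * ENNReal.ofReal x ^ k * ENNReal.ofReal (1 - y) ^ (h - k) := by
  rw [binomialWeight, ENNReal.ofReal_mul (by positivity), ENNReal.ofReal_mul (Nat.cast_nonneg _),
    ENNReal.ofReal_natCast, ENNReal.ofReal_pow hx, ENNReal.ofReal_pow (sub_nonneg.2 hy)]

lemma Marking.HasRates.edgeLaw_outerGood (h : m.HasRates s a b) (p q : unitInterval)
    (H : Finset (Fin n)) (k : ℕ) (σ : Labeling n) (v : Fin n) :
    (edgeLaw p q s σ).toMeasure (m.outerGood H k σ v) =
      ENNReal.ofReal (binomialWeight (p * a) (p * b) (outerClass H σ (σ v)).card k *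
        binomialWeight (q * a) (q * b) (outerClass H σ (-σ v)).card k) := by
  let r : ℤˣ → unitInterval := fun c => if σ v = c then p else q
  have measure_exactly : ∀ c, (edgeLaw p q s σ).toMeasure (m.exactly (star v (outerClass H σ c)) k)
      = ENNReal.ofReal (binomialWeight (r c * a) (r c * b) (outerClass H σ c).card k) := fun c => by
    have pairProb_eq : ∀ e ∈ star v (outerClass H σ c), pairProb p q σ e = r c := fun e he => by
      obtain ⟨u, hu, rfl⟩ := Finset.mem_image.1 he
      rw [pairProb_mk, (Finset.mem_filter.1 hu).2]
    rw [edgeLaw, toMeasure_indep, m.measure_exactly _ _ k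
      (fun e he => by rw [pairProb_eq e he, toMeasure_pairLaw, h.sum_marked])
      (fun e he => by rw [pairProb_eq e he, toMeasure_pairLaw, h.sum_neutral]),
      ofReal_binomialWeight (mul_nonneg (r c).2.1 h.nonneg_marked) (h.mul_le_one _), star,
      Finset.card_image_of_injective _ (star_injective v)]
  have univ_eq : (Finset.univ : Finset ℤˣ) = {σ v, -σ v} :=
    (by decide : ∀ c : ℤˣ, Finset.univ = {c, -c}) (σ v)
  have ne_neg : σ v ≠ -σ v := (by decide : ∀ c : ℤˣ, c ≠ -c) (σ v)
  have outerGood_eq : m.outerGood H k σ v =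
      ⋂ c ∈ Finset.univ, m.exactly (star v (outerClass H σ c)) k := by
    simp only [outerGood, Finset.mem_univ, Set.iInter_true]
  have measure_inter := measure_pi_biInter (fun e => (pairLaw (pairProb p q σ e) s).toMeasure)
    (S := fun c => star v (outerClass H σ c)) (B := Finset.univ)
    (fun c _ c' _ hne => disjoint_star_outerClass H σ v hne) fun c _ => m.dependsOn_exactly _ k
  rw [← toMeasure_indep, ← outerGood_eq] at measure_inter
  rw [edgeLaw, measure_inter, ← edgeLaw, Finset.prod_congr rfl fun c _ => measure_exactly c,
    univ_eq, Finset.prod_pair ne_neg, ← ENNReal.ofReal_mul (binomialWeight_nonneg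
      (mul_nonneg (r _).2.1 h.nonneg_marked) (h.mul_le_one _) _ _)]
  simp only [r, if_true, if_neg ne_neg]

lemma Marking.HasRates.edgeLaw_compl_innerGood_le (h : m.HasRates s a b) (p q : unitInterval)
    (H : Finset (Fin n)) (σ : Labeling n) (v : Fin n) :
    (edgeLaw p q s σ).toMeasure (m.innerGood H v)ᶜ ≤ ENNReal.ofReal (H.card * max (p : ℝ) q) := by
  have subset_iUnion : (m.innerGood H v)ᶜ ⊆
      ⋃ e ∈ star v H, Function.eval e ⁻¹' (m.neutral : Set (Bool × Bool))ᶜ := fun x hx => by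
    simpa [innerGood] using hx
  have measure_le : ∀ e : Sym2 (Fin n), (edgeLaw p q s σ).toMeasure
      (Function.eval e ⁻¹' (m.neutral : Set (Bool × Bool))ᶜ) ≤
        ENNReal.ofReal (max (p : ℝ) q) := fun e => by
    rw [edgeLaw, toMeasure_indep, (measurePreserving_eval _ e).measure_preimage
      (Set.toFinite _).measurableSet.nullMeasurableSet]
    refine (h.toMeasure_compl_neutral_le _).trans (ENNReal.ofReal_le_ofReal ?_)
    unfold pairProb
    split_ifs
    exacts [le_max_left _ _, le_max_right _ _]
  calc (edgeLaw p q s σ).toMeasure (m.innerGood H v)ᶜ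
      ≤ ∑ _ ∈ star v H, ENNReal.ofReal (max (p : ℝ) q) :=
        (measure_mono subset_iUnion).trans <| (measure_biUnion_finset_le _ _).trans <|
          Finset.sum_le_sum fun e _ => measure_le e
    _ = ENNReal.ofReal (H.card * max (p : ℝ) q) := by
        rw [Finset.sum_const, star, Finset.card_image_of_injective _ (star_injective v),
          nsmul_eq_mul, ENNReal.ofReal_mul (Nat.cast_nonneg _), ENNReal.ofReal_natCast]

lemma Marking.HasRates.edgeLaw_forall_notMem_good_le (h : m.HasRates s a b) (d : ℤˣ) {c : ℝ}
    (hc : 0 ≤ c) (hcw : c ≤ binomialWeight (p * a) (p * b) (outerClass H σ d).card k *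
      binomialWeight (q * a) (q * b) (outerClass H σ (-d)).card k) :
    (edgeLaw p q s σ).toOuterMeasure {x | ∀ v ∈ H, σ v = d → x ∉ m.good H k σ v} ≤
      ENNReal.ofReal (Real.exp (-c * Finset.card {v ∈ H | σ v = d}) +
        H.card * max (p : ℝ) q) := by
  have le_exp : 1 - ENNReal.ofReal c ≤ ENNReal.ofReal (Real.exp (-c)) := by
    rw [← ENNReal.ofReal_one, ← ENNReal.ofReal_sub _ hc]
    exact ENNReal.ofReal_le_ofReal (Real.one_sub_le_exp_neg c)
  have event_eq : {x | ∀ v ∈ H, σ v = d → x ∉ m.good H k σ v} =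
      {x | ∀ v ∈ ({v ∈ H | σ v = d} : Finset _), x ∉ m.outerGood H k σ v ∩ m.innerGood H v} := by
    simp only [Finset.mem_filter, and_imp, good]
  have measure_le := measure_pi_forall_notMem_inter_le
    (fun e => (pairLaw (pairProb p q σ e) s).toMeasure) (B := {v ∈ H | σ v = d})
    ((pairwiseDisjoint_star_compl H).subset (Finset.coe_subset.2 (Finset.filter_subset _ _)))
    (disjoint_star_compl_sym2 H _) (fun v _ => m.dependsOn_outerGood H k σ v)
    (fun v hv => m.dependsOn_innerGood (Finset.mem_filter.1 hv).1) (c := ENNReal.ofReal c)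
    (ε := ENNReal.ofReal (H.card * max (p : ℝ) q))
    (fun v hv => by
      rw [← toMeasure_indep, ← edgeLaw, h.edgeLaw_outerGood, (Finset.mem_filter.1 hv).2]
      exact ENNReal.ofReal_le_ofReal hcw)
    (fun v _ => by
      rw [← toMeasure_indep, ← edgeLaw]
      exact h.edgeLaw_compl_innerGood_le p q H σ v)
  rw [← toMeasure_indep, ← edgeLaw, ← event_eq] at measure_le
  rw [← PMF.toMeasure_apply_eq_toOuterMeasure]
  refine measure_le.trans ?_
  rw [ENNReal.ofReal_add (Real.exp_nonneg _) (mul_nonneg (Nat.cast_nonneg _)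
    (p.2.1.trans (le_max_left _ _))), mul_comm (-c), Real.exp_nat_mul,
    ENNReal.ofReal_pow (Real.exp_nonneg _)]
  gcongr

end GoodVertices

section GoodPair

open MeasureTheory

variable {n : ℕ}

/-- The event that `H` contains good vertices with either label. -/
def Marking.goodPair (m : Marking (Bool × Bool)) (k : ℕ) (H : Finset (Fin n)) : Set (Config n) :=
  {z | ∀ c : ℤˣ, ∃ v ∈ H, z.labels v = c ∧ z.pairs ∈ m.good H k z.labels v}

/-- The event that the labels in `S` are unbalanced, by a proportion `δ`. -/
def unbalanced (δ : ℝ) (S : Finset (Fin n)) : Set (Labeling n) :=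
  {σ | δ * S.card ≤ |labelSum S σ|}

variable {m : Marking (Bool × Bool)} {p q s : unitInterval} {a b c δ : ℝ} {H : Finset (Fin n)}
  {k : ℕ} {σ : Labeling n}

lemma abs_card_outerClass_sub_le (hσ : σ ∉ unbalanced δ Hᶜ) (hH : H.card ≤ δ * n)
    (hδ : 0 < δ) (c : ℤˣ) : |((outerClass H σ c).card : ℝ) - n / 2| ≤ δ * n := by
  have card_compl : (Hᶜ.card : ℝ) = n - H.card := by
    rw [Finset.card_compl, Fintype.card_fin, Nat.cast_sub (card_finset_fin_le H)]
  have h := abs_card_filter_label_sub_le (not_le.1 hσ).le c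
  rw [← outerClass, card_compl] at h
  rw [abs_le] at h ⊢
  constructor <;> nlinarith [(Nat.cast_nonneg H.card : (0 : ℝ) ≤ H.card)]

lemma card_div_four_le (hσ : σ ∉ unbalanced δ H) (hδ : δ ≤ 1 / 2) (c : ℤˣ) :
    (H.card : ℝ) / 4 ≤ Finset.card {v ∈ H | σ v = c} := by
  have h := (abs_le.1 (abs_card_filter_label_sub_le (not_le.1 hσ).le c)).1
  nlinarith [(Nat.cast_nonneg H.card : (0 : ℝ) ≤ H.card)]

lemma labelLaw_unbalanced_le {S : Finset (Fin n)} (hδ : 0 < δ) {t : ℝ} (ht : 0 < t)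
    (htS : t ≤ S.card) :
    (labelLaw n).toOuterMeasure (unbalanced δ S) ≤ ENNReal.ofReal (1 / (δ ^ 2 * t)) := by
  have hS : S.Nonempty := Finset.card_pos.1 (by exact_mod_cast ht.trans_le htS)
  exact (labelLaw_chebyshev hS hδ).trans (ENNReal.ofReal_le_ofReal (by gcongr))

lemma Marking.HasRates.configLaw_compl_goodPair_le (h : m.HasRates s a b) (hH : H.Nonempty)
    (hδ : 0 < δ) (hδ' : δ ≤ 1 / 2) (hHn : H.card ≤ δ * n) (hc : 0 ≤ c)
    (hcw : ∀ h₁ h₂ : ℕ, |(h₁ : ℝ) - n / 2| ≤ δ * n → |(h₂ : ℝ) - n / 2| ≤ δ * n →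
      c ≤ binomialWeight (p * a) (p * b) h₁ k * binomialWeight (q * a) (q * b) h₂ k) :
    (configLaw n p q s).toOuterMeasure (m.goodPair k H)ᶜ ≤
      ENNReal.ofReal (2 / (δ ^ 2 * H.card) +
        2 * (Real.exp (-(c * H.card / 4)) + H.card * max (p : ℝ) q)) := by
  have card_pos : (0 : ℝ) < H.card := by exact_mod_cast hH.card_pos
  have max_nonneg : 0 ≤ max (p : ℝ) q := p.2.1.trans (le_max_left _ _)
  let noGood : ℤˣ → Labeling n → Set (Sym2 (Fin n) → Bool × Bool) := fun d σ =>
    {x | ∀ v ∈ H, σ v = d → x ∉ m.good H k σ v}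
  have compl_eq : (m.goodPair k H)ᶜ =
      {z : Config n | z.pairs ∈ noGood 1 z.labels ∪ noGood (-1) z.labels} := by
    ext z
    simp only [goodPair, noGood, Set.mem_compl_iff, Set.mem_ofPred_eq, Set.mem_union,
      not_forall, not_exists, not_and]
    refine ⟨fun ⟨d, hd⟩ => ?_, fun hz => hz.elim (fun hd => ⟨1, hd⟩) fun hd => ⟨-1, hd⟩⟩
    rcases Int.units_eq_one_or d with rfl | rfl
    exacts [.inl hd, .inr hd]
  have edgeLaw_le : ∀ σ ∉ unbalanced δ H ∪ unbalanced δ Hᶜ, ∀ d,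
      (edgeLaw p q s σ).toOuterMeasure (noGood d σ) ≤
        ENNReal.ofReal (Real.exp (-(c * H.card / 4)) + H.card * max (p : ℝ) q) := fun σ hσ d => by
    obtain ⟨hin, hout⟩ := not_or.1 hσ
    have outer := abs_card_outerClass_sub_le hout hHn hδ
    have inner := card_div_four_le hin hδ' d
    refine (h.edgeLaw_forall_notMem_good_le d hc (hcw _ _ (outer d) (outer (-d)))).trans ?_
    gcongr
    nlinarith
  have compl_card : (H.card : ℝ) ≤ Hᶜ.card := by
    rw [Finset.card_compl, Fintype.card_fin, Nat.cast_sub (card_finset_fin_le H)]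
    nlinarith
  rw [compl_eq]
  refine (configLaw_toOuterMeasure_le p q s (A := unbalanced δ H ∪ unbalanced δ Hᶜ)
    fun σ hσ => (measure_union_le _ _).trans (add_le_add (edgeLaw_le σ hσ 1)
      (edgeLaw_le σ hσ (-1)))).trans ((add_le_add_left ((measure_union_le _ _).trans
        (add_le_add (labelLaw_unbalanced_le hδ card_pos le_rfl)
          (labelLaw_unbalanced_le hδ card_pos compl_card))) _).trans_eq ?_)
  rw [← two_mul, ← two_mul, ← ENNReal.ofReal_ofNat, ← ENNReal.ofReal_mul, ← ENNReal.ofReal_mul,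
    ← ENNReal.ofReal_add] <;> first | positivity | ring_nf

end GoodPair

lemma unionMarking_hasRates (s : unitInterval) :
    unionMarking.HasRates s (1 - (1 - (s : ℝ)) ^ 2) (1 - (1 - (s : ℝ)) ^ 2) where
  sum_marked r := by
    rw [unionMarking, Finset.sum_insert (by decide), Finset.sum_pair (by decide)]
    simp only [pairWeight]
    ring
  sum_neutral r := by
    rw [unionMarking, Finset.sum_singleton, pairWeight, noneWeight]
    ring

lemma firstMarking_hasRates (s : unitInterval) :
    firstMarking.HasRates s (s * (1 - (s : ℝ))) s where
  sum_marked r := Finset.sum_singleton _ _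
  sum_neutral r := by
    rw [firstMarking, Finset.sum_pair (by decide)]
    simp only [pairWeight, noneWeight]
    ring

/-! ### Asymptotics of the probability of a good vertex -/

section Asymptotics

lemma factorial_mul_exp_le (k : ℕ) :
    (k.factorial : ℝ) * Real.exp k ≤ Real.exp 1 * (k + 1) * (k : ℝ) ^ k := by
  rcases eq_or_ne k 0 with rfl | hk
  · simp
  have stirlingSeq_le : Stirling.stirlingSeq k ≤ Real.exp 1 / √2 := by
    have := Stirling.stirlingSeq'_antitone (Nat.zero_le (k - 1))
    rwa [Function.comp_apply, Function.comp_apply, Nat.succ_eq_add_one,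
      Nat.sub_add_cancel (Nat.one_le_iff_ne_zero.2 hk), Nat.succ_eq_add_one, zero_add,
      Stirling.stirlingSeq_one] at this
  have sqrt_le : √(k : ℝ) ≤ k + 1 := Real.sqrt_le_iff.2 ⟨by positivity, by nlinarith⟩
  rw [Stirling.stirlingSeq, div_le_iff₀ (by positivity)] at stirlingSeq_le
  calc (k.factorial : ℝ) * Real.exp k
      ≤ Real.exp 1 / √2 * (√(2 * k) * (k / Real.exp 1) ^ k) * Real.exp k := by gcongr
    _ = Real.exp 1 * √k * (k : ℝ) ^ k := by
        rw [Real.sqrt_mul zero_le_two, div_pow, ← Real.exp_nat_mul, mul_one]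
        field_simp
    _ ≤ Real.exp 1 * (k + 1) * (k : ℝ) ^ k := by gcongr

-- The mode of a Poisson distribution is the integer part of its mean `X`.
lemma exp_div_le_pow_floor_div_factorial {X : ℝ} (hX : 0 ≤ X) :
    Real.exp (X - 2) / (X + 1) ≤ X ^ ⌊X⌋₊ / (⌊X⌋₊.factorial : ℝ) := by
  have floor_le : (⌊X⌋₊ : ℝ) ≤ X := Nat.floor_le hX
  have lt_floor : X < ⌊X⌋₊ + 1 := Nat.lt_floor_add_one X
  rw [div_le_div_iff₀ (by positivity) (by positivity)]
  calc Real.exp (X - 2) * (⌊X⌋₊.factorial : ℝ)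
      ≤ Real.exp (-1 + ⌊X⌋₊) * ⌊X⌋₊.factorial := by
        gcongr
        linarith
    _ = (⌊X⌋₊.factorial * Real.exp ⌊X⌋₊) / Real.exp 1 := by
        rw [Real.exp_add, Real.exp_neg]
        ring
    _ ≤ (Real.exp 1 * (⌊X⌋₊ + 1) * (⌊X⌋₊ : ℝ) ^ ⌊X⌋₊) / Real.exp 1 :=
        div_le_div_of_nonneg_right (factorial_mul_exp_le _) (Real.exp_pos _).le
    _ = (⌊X⌋₊ : ℝ) ^ ⌊X⌋₊ * (⌊X⌋₊ + 1) := by field_simp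
    _ ≤ X ^ ⌊X⌋₊ * (X + 1) := by gcongr

lemma exp_neg_le_one_sub_pow {x δ : ℝ} (hx : 0 ≤ x) (hxδ : x ≤ δ) (hδ : δ ≤ 1 / 2) (h : ℕ) :
    Real.exp (-(x * (1 + 2 * δ) * h)) ≤ (1 - x) ^ h := by
  have one_sub_pos : 0 < 1 - x := by linarith
  have le_log : -(x * (1 + 2 * δ)) ≤ Real.log (1 - x) := by
    refine le_trans ?_ (Real.one_sub_inv_le_log_of_pos one_sub_pos)
    rw [show 1 - (1 - x)⁻¹ = -(x / (1 - x)) by field_simp; ring, neg_le_neg_iff,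
      div_le_iff₀ one_sub_pos, mul_assoc]
    refine le_mul_of_one_le_right hx ?_
    nlinarith
  calc Real.exp (-(x * (1 + 2 * δ) * h)) = Real.exp (-(x * (1 + 2 * δ))) ^ h := by
        rw [← Real.exp_nat_mul]
        ring_nf
    _ ≤ (1 - x) ^ h := by
        gcongr
        rwa [← Real.le_log_iff_exp_le one_sub_pos]

lemma pow_div_factorial_mul_exp_le_binomialWeight {x y δ : ℝ} (hx : 0 ≤ x) (hy : 0 ≤ y)
    (hyδ : y ≤ δ) (hδ : δ ≤ 1 / 2) {h k : ℕ} (hkh : k ≤ h) :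
    ((h - k) * x) ^ k / k.factorial * Real.exp (-(y * (1 + 2 * δ) * h)) ≤
      binomialWeight x y h k := by
  have sub_nonneg : (0 : ℝ) ≤ h - k := sub_nonneg.2 (by exact_mod_cast hkh)
  have le_choose : ((h : ℝ) - k) ^ k / k.factorial ≤ h.choose k := by
    refine le_trans ?_ (Nat.pow_le_choose k h)
    rw [Nat.cast_sub (by lia)]
    gcongr
    simp
  have le_pow : Real.exp (-(y * (1 + 2 * δ) * h)) ≤ (1 - y) ^ (h - k) :=
    (exp_neg_le_one_sub_pow hy hyδ hδ h).trans
      (pow_le_pow_of_le_one (by linarith) (by linarith) (Nat.sub_le h k))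
  rw [mul_pow, mul_div_right_comm]
  unfold binomialWeight
  gcongr

lemma le_binomialWeight_log {γ a b δ l x : ℝ} (hγ : 0 ≤ γ) (ha : 0 ≤ a) (hb : 0 ≤ b)
    (hδ : 0 ≤ δ) (hδ' : δ ≤ 1 / 8) (hl : 0 ≤ l) (hx : 0 < x) {h k : ℕ}
    (hh : |(h : ℝ) - x / 2| ≤ δ * x) (hk : (k : ℝ) ≤ δ * x) (hy : γ * l / x * b ≤ δ) :
    ((1 - 4 * δ) * (γ * a * l / 2)) ^ k / k.factorial *
      Real.exp (-(γ * b * l / 2 * (1 + 2 * δ) ^ 2)) ≤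
        binomialWeight (γ * l / x * a) (γ * l / x * b) h k := by
  obtain ⟨lower, upper⟩ := abs_le.1 hh
  have sub_le : (1 / 2 - 2 * δ) * x ≤ h - k := by linarith
  have base_nonneg : 0 ≤ (1 / 2 - 2 * δ) * x := mul_nonneg (by linarith) hx.le
  have sub_nonneg : (0 : ℝ) ≤ h - k := base_nonneg.trans sub_le
  have hkh : k ≤ h := by
    have : (k : ℝ) ≤ h := by linarith
    exact_mod_cast this
  refine le_trans ?_ (pow_div_factorial_mul_exp_le_binomialWeight (by positivity) (by positivity)
    hy (by linarith) hkh)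
  have base_eq : (1 - 4 * δ) * (γ * a * l / 2) = (1 / 2 - 2 * δ) * x * (γ * l / x * a) := by
    field_simp
    ring
  have exponent_eq : γ * b * l / 2 * (1 + 2 * δ) ^ 2 =
      γ * l / x * b * (1 + 2 * δ) * (x / 2 * (1 + 2 * δ)) := by field_simp
  rw [base_eq, exponent_eq]
  gcongr
  linarith

lemma exp_le_pow_floor_div_factorial_mul {X δ u v : ℝ} (hX : 0 ≤ X) (hδ : 0 ≤ δ)
    (hδ' : δ ≤ 1 / 8) (huv : u * v = X ^ 2) :
    Real.exp (2 * X * (1 - 8 * δ) - 4) / (X + 1) ^ 2 ≤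
      ((1 - 4 * δ) * u) ^ ⌊X⌋₊ / ⌊X⌋₊.factorial *
        (((1 - 4 * δ) * v) ^ ⌊X⌋₊ / ⌊X⌋₊.factorial) := by
  have base_nonneg : 0 ≤ 1 - 4 * δ := by linarith
  have exp_le : Real.exp (-(16 * δ * X)) ≤ (1 - 4 * δ) ^ (2 * ⌊X⌋₊) := by
    refine le_trans (Real.exp_le_exp.2 (neg_le_neg ?_))
      (exp_neg_le_one_sub_pow (by linarith) le_rfl (by linarith) _)
    have floor_le := Nat.floor_le hX
    push_cast
    calc 4 * δ * (1 + 2 * (4 * δ)) * (2 * ⌊X⌋₊) ≤ 4 * δ * 2 * (2 * X) := by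
          gcongr
          linarith
      _ = 16 * δ * X := by ring
  calc Real.exp (2 * X * (1 - 8 * δ) - 4) / (X + 1) ^ 2
      = Real.exp (-(16 * δ * X)) * (Real.exp (X - 2) / (X + 1)) ^ 2 := by
        rw [div_pow, ← Real.exp_nat_mul, ← mul_div_assoc, ← Real.exp_add]
        ring_nf
    _ ≤ (1 - 4 * δ) ^ (2 * ⌊X⌋₊) * (X ^ ⌊X⌋₊ / ⌊X⌋₊.factorial) ^ 2 :=
        mul_le_mul exp_le (pow_le_pow_left₀ (by positivity)
          (exp_div_le_pow_floor_div_factorial hX) 2) (by positivity) (by positivity)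
    _ = (1 - 4 * δ) ^ (2 * ⌊X⌋₊) * (u * v) ^ ⌊X⌋₊ / (⌊X⌋₊.factorial : ℝ) ^ 2 := by
        rw [huv]
        ring
    _ = ((1 - 4 * δ) * u) ^ ⌊X⌋₊ / ⌊X⌋₊.factorial *
        (((1 - 4 * δ) * v) ^ ⌊X⌋₊ / ⌊X⌋₊.factorial) := by
        simp only [mul_pow]
        ring

/-- The exponent of `1 / n` in the lower bound for the probability that a vertex is good, if all
community sizes are known up to a proportion `δ`. -/
noncomputable def goodExponent (α β a b δ : ℝ) : ℝ :=
  b * ((α + β) / 2) * (1 + 2 * δ) ^ 2 - a * √(α * β) * (1 - 8 * δ)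

/-- The most likely number of marked pairs that join a vertex to each community if it is equally
large in both, with `l` in place of `log n`. -/
noncomputable def markedDegree (α β a l : ℝ) : ℕ := ⌊a * √(α * β) * l / 2⌋₊

lemma le_binomialWeight_mul {α β a b δ l x : ℝ} (hα : 0 ≤ α) (hβ : 0 ≤ β) (ha : 0 ≤ a)
    (hb : 0 ≤ b) (hδ : 0 ≤ δ) (hδ' : δ ≤ 1 / 8) (hl : 0 ≤ l) (hx : 0 < x)
    (hX : a * √(α * β) * l / 2 ≤ δ * x) (hα' : α * l / x * b ≤ δ) (hβ' : β * l / x * b ≤ δ)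
    {h₁ h₂ : ℕ} (hh₁ : |(h₁ : ℝ) - x / 2| ≤ δ * x) (hh₂ : |(h₂ : ℝ) - x / 2| ≤ δ * x) :
    Real.exp (-(goodExponent α β a b δ * l) - 4) / (a * √(α * β) * l / 2 + 1) ^ 2 ≤
      binomialWeight (α * l / x * a) (α * l / x * b) h₁ (markedDegree α β a l) *
        binomialWeight (β * l / x * a) (β * l / x * b) h₂ (markedDegree α β a l) := by
  have X_nonneg : 0 ≤ a * √(α * β) * l / 2 := by positivity
  have one_sub_nonneg : 0 ≤ 1 - 4 * δ := by linarith
  have degree_le : (markedDegree α β a l : ℝ) ≤ δ * x := (Nat.floor_le X_nonneg).trans hX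
  have weight₁ := le_binomialWeight_log hα ha hb hδ hδ' hl hx hh₁ degree_le hα'
  have weight₂ := le_binomialWeight_log hβ ha hb hδ hδ' hl hx hh₂ degree_le hβ'
  have degrees := exp_le_pow_floor_div_factorial_mul (u := α * a * l / 2) (v := β * a * l / 2)
    X_nonneg hδ hδ' (by
      rw [div_pow, mul_pow, mul_pow, Real.sq_sqrt (by positivity)]
      ring)
  calc Real.exp (-(goodExponent α β a b δ * l) - 4) / (a * √(α * β) * l / 2 + 1) ^ 2
      = Real.exp (2 * (a * √(α * β) * l / 2) * (1 - 8 * δ) - 4) /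
          (a * √(α * β) * l / 2 + 1) ^ 2 *
        (Real.exp (-(α * b * l / 2 * (1 + 2 * δ) ^ 2)) *
          Real.exp (-(β * b * l / 2 * (1 + 2 * δ) ^ 2))) := by
        rw [div_mul_eq_mul_div, ← Real.exp_add, ← Real.exp_add, goodExponent]
        ring_nf
    _ ≤ _ := mul_le_mul_of_nonneg_right degrees (by positivity)
    _ = _ := mul_mul_mul_comm _ _ _ _
    _ ≤ _ := mul_le_mul weight₁ weight₂ (by positivity) (le_trans (by positivity) weight₁)

lemma tendsto_log_natCast_atTop : Tendsto (fun n : ℕ => Real.log n) atTop atTop :=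
  Real.tendsto_log_atTop.comp tendsto_natCast_atTop_atTop

lemma eventually_mul_log_div_le (C : ℝ) {δ : ℝ} (hδ : 0 < δ) :
    ∀ᶠ n : ℕ in atTop, C * Real.log n / n ≤ δ := by
  have h := ((Real.isLittleO_log_id_atTop.tendsto_div_nhds_zero).comp
    tendsto_natCast_atTop_atTop).const_mul C
  rw [mul_zero] at h
  filter_upwards [h.eventually_le_const hδ] with n hn
  rwa [mul_div_assoc]

lemma eventually_sq_le_exp {C ε : ℝ} (hC : 0 ≤ C) (hε : 0 < ε) :
    ∀ᶠ l : ℝ in atTop, (C * l + 1) ^ 2 ≤ Real.exp (ε * l - 4) := by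
  have isLittleO := (isLittleO_pow_exp_pos_mul_atTop 2 hε).bound
    (show 0 < Real.exp (-4) / (C + 1) ^ 2 by positivity)
  filter_upwards [isLittleO, eventually_ge_atTop 1] with l hl one_le
  rw [Real.norm_of_nonneg (by positivity), Real.norm_of_nonneg (Real.exp_pos _).le,
    div_mul_eq_mul_div, le_div_iff₀ (by positivity), ← Real.exp_add] at hl
  calc (C * l + 1) ^ 2 ≤ (C * l + l) ^ 2 := by gcongr
    _ = l ^ 2 * (C + 1) ^ 2 := by ring
    _ ≤ Real.exp (-4 + ε * l) := hl
    _ = Real.exp (ε * l - 4) := by ring_nf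

lemma exists_goodExponent_lt_one {α β a b : ℝ} (h : b * ((α + β) / 2) - a * √(α * β) < 1) :
    ∃ δ, 0 < δ ∧ δ ≤ 1 / 8 ∧ goodExponent α β a b δ < 1 := by
  have continuous : Continuous (goodExponent α β a b) := by
    unfold goodExponent
    fun_prop
  have at_zero : goodExponent α β a b 0 < 1 := by simpa [goodExponent] using h
  have near_zero : ∀ᶠ δ in 𝓝[>] (0 : ℝ), goodExponent α β a b δ < 1 ∧ δ < 1 / 8 :=
    ((continuous.continuousAt.eventually_lt_const at_zero).and
      (eventually_lt_nhds (by norm_num))).filter_mono nhdsWithin_le_nhds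
  obtain ⟨δ, ⟨hlt, hδ'⟩, hδ⟩ := (near_zero.and self_mem_nhdsWithin).exists
  exact ⟨δ, hδ, hδ'.le, hlt⟩

lemma eventually_rpow_le_binomialWeight_mul {α β a b δ θ : ℝ} (hα : 0 ≤ α) (hβ : 0 ≤ β)
    (ha : 0 ≤ a) (hb : 0 ≤ b) (hδ : 0 < δ) (hδ' : δ ≤ 1 / 8)
    (hθ : goodExponent α β a b δ < θ) :
    ∀ᶠ n : ℕ in atTop, ∀ h₁ h₂ : ℕ, |(h₁ : ℝ) - n / 2| ≤ δ * n → |(h₂ : ℝ) - n / 2| ≤ δ * n →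
      (n : ℝ) ^ (-θ) ≤
        binomialWeight (α * Real.log n / n * a) (α * Real.log n / n * b) h₁
            (markedDegree α β a (Real.log n)) *
          binomialWeight (β * Real.log n / n * a) (β * Real.log n / n * b) h₂
            (markedDegree α β a (Real.log n)) := by
  have hC : 0 ≤ a * √(α * β) / 2 := by positivity
  filter_upwards [eventually_mul_log_div_le (a * √(α * β) / 2) hδ,
    eventually_mul_log_div_le (α * b) hδ, eventually_mul_log_div_le (β * b) hδ,
    tendsto_log_natCast_atTop.eventually (eventually_sq_le_exp hC (sub_pos.2 hθ)),
    eventually_gt_atTop 0] with n hX hα' hβ' hsq hn h₁ h₂ hh₁ hh₂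
  have n_pos : (0 : ℝ) < n := by exact_mod_cast hn
  rw [mul_right_comm, mul_div_right_comm] at hα' hβ'
  rw [div_le_iff₀ n_pos, ← mul_div_right_comm] at hX
  refine le_trans ?_ (le_binomialWeight_mul hα hβ ha hb hδ.le hδ' (Real.log_natCast_nonneg n)
    n_pos hX hα' hβ' hh₁ hh₂)
  rw [← mul_div_right_comm] at hsq
  rw [le_div_iff₀ (by positivity), Real.rpow_def_of_pos n_pos]
  calc Real.exp (Real.log n * -θ) * (a * √(α * β) * Real.log n / 2 + 1) ^ 2
      ≤ Real.exp (Real.log n * -θ) *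
          Real.exp ((θ - goodExponent α β a b δ) * Real.log n - 4) := by gcongr
    _ = Real.exp (-(goodExponent α β a b δ * Real.log n) - 4) := by
      rw [← Real.exp_add]
      ring_nf

end Asymptotics

/-! ### Disjoint blocks of vertices -/

section Blocks

lemma exists_disjoint_blocks {n K t : ℕ} (h : K * t ≤ n) :
    ∃ H : Fin K → Finset (Fin n), (Pairwise fun i j => Disjoint (H i) (H j)) ∧
      ∀ j, (H j).card = t := by
  let f : Fin K × Fin t → Fin n := Fin.castLE h ∘ finProdFinEquiv
  have hf : Function.Injective f := (Fin.castLE_injective h).comp finProdFinEquiv.injective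
  refine ⟨fun j => Finset.univ.image fun i => f (j, i), fun j j' hj => ?_, fun j => ?_⟩
  · refine Finset.disjoint_left.2 fun v hv hv' => hj ?_
    obtain ⟨i, -, rfl⟩ := Finset.mem_image.1 hv
    obtain ⟨i', -, h'⟩ := Finset.mem_image.1 hv'
    exact (congrArg Prod.fst (hf h')).symm
  · rw [Finset.card_image_of_injective _ fun i i' hi => congrArg Prod.snd (hf hi),
      Finset.card_univ, Fintype.card_fin]

lemma tendsto_natCast_rpow_atTop {κ : ℝ} (hκ : 0 < κ) :
    Tendsto (fun n : ℕ => (n : ℝ) ^ κ) atTop atTop :=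
  (tendsto_rpow_atTop hκ).comp tendsto_natCast_atTop_atTop

lemma tendsto_rpow_neg_mul_floor_rpow {θ κ : ℝ} (hθ : 0 ≤ θ) (hκ : θ < κ) :
    Tendsto (fun n : ℕ => (n : ℝ) ^ (-θ) * ⌊(n : ℝ) ^ κ⌋₊) atTop atTop := by
  refine tendsto_atTop_mono' _ ?_ (tendsto_atTop_add_const_right _ (-1 : ℝ)
    (tendsto_natCast_rpow_atTop (sub_pos.2 hκ)))
  filter_upwards [eventually_ge_atTop 1] with n hn
  have one_le : (1 : ℝ) ≤ n := by exact_mod_cast hn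
  calc (n : ℝ) ^ (κ - θ) + -1 ≤ (n : ℝ) ^ (κ - θ) - (n : ℝ) ^ (-θ) := by
        linarith [Real.rpow_le_one_of_one_le_of_nonpos one_le (neg_nonpos.2 hθ)]
    _ = (n : ℝ) ^ (-θ) * ((n : ℝ) ^ κ - 1) := by
        rw [mul_sub, ← Real.rpow_add (by linarith), mul_one]
        ring_nf
    _ ≤ (n : ℝ) ^ (-θ) * ⌊(n : ℝ) ^ κ⌋₊ := by
        gcongr
        exact (Nat.sub_one_lt_floor _).le

lemma tendsto_floor_rpow_mul_log_div {κ : ℝ} (hκ : κ < 1) :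
    Tendsto (fun n : ℕ => (⌊(n : ℝ) ^ κ⌋₊ : ℝ) * (Real.log n / n)) atTop (𝓝 0) := by
  have log_div : Tendsto (fun n : ℕ => Real.log n / (n : ℝ) ^ (1 - κ)) atTop (𝓝 0) :=
    (isLittleO_log_rpow_atTop (sub_pos.2 hκ)).tendsto_div_nhds_zero.comp
      tendsto_natCast_atTop_atTop
  have log_div_nonneg : ∀ n : ℕ, 0 ≤ Real.log n / n := fun n =>
    div_nonneg (Real.log_natCast_nonneg n) (Nat.cast_nonneg n)
  refine squeeze_zero' (Eventually.of_forall fun n =>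
    mul_nonneg (Nat.cast_nonneg _) (log_div_nonneg n)) ?_ log_div
  filter_upwards [eventually_gt_atTop 0] with n hn
  have n_pos : (0 : ℝ) < n := by exact_mod_cast hn
  calc (⌊(n : ℝ) ^ κ⌋₊ : ℝ) * (Real.log n / n) ≤ (n : ℝ) ^ κ * (Real.log n / n) :=
        mul_le_mul_of_nonneg_right (Nat.floor_le (by positivity)) (log_div_nonneg n)
    _ = Real.log n / (n : ℝ) ^ (1 - κ) := by
        rw [Real.rpow_sub n_pos, Real.rpow_one]
        field_simp

lemma exists_blockSize {θ : ℝ} (hθ : 0 ≤ θ) (hθ' : θ < 1) :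
    ∃ t : ℕ → ℕ, Tendsto t atTop atTop ∧
      Tendsto (fun n : ℕ => (n : ℝ) ^ (-θ) * t n) atTop atTop ∧
      Tendsto (fun n : ℕ => (t n : ℝ) * (Real.log n / n)) atTop (𝓝 0) := by
  obtain ⟨κ, hκ, hκ'⟩ := exists_between hθ'
  exact ⟨fun n => ⌊(n : ℝ) ^ κ⌋₊,
    tendsto_nat_floor_atTop.comp (tendsto_natCast_rpow_atTop (hθ.trans_lt hκ)),
    tendsto_rpow_neg_mul_floor_rpow hθ hκ, tendsto_floor_rpow_mul_log_div hκ'⟩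

variable {t : ℕ → ℕ}

lemma eventually_natCast_le_mul (ht : Tendsto (fun n : ℕ => (t n : ℝ) * (Real.log n / n))
    atTop (𝓝 0)) {ε : ℝ} (hε : 0 < ε) : ∀ᶠ n : ℕ in atTop, (t n : ℝ) ≤ ε * n := by
  filter_upwards [ht.eventually_le_const hε, tendsto_log_natCast_atTop.eventually_ge_atTop 1,
    eventually_gt_atTop 0] with n hn one_le_log n_pos
  rw [← mul_div_assoc, div_le_iff₀ (by exact_mod_cast n_pos)] at hn
  exact (le_mul_of_one_le_right (Nat.cast_nonneg _) one_le_log).trans hn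

lemma tendsto_blockError {δ θ : ℝ} (hδ : 0 < δ) (C : ℝ) (ht : Tendsto t atTop atTop)
    (hθ : Tendsto (fun n : ℕ => (n : ℝ) ^ (-θ) * t n) atTop atTop)
    (hlog : Tendsto (fun n : ℕ => (t n : ℝ) * (Real.log n / n)) atTop (𝓝 0)) :
    Tendsto (fun n : ℕ => 2 / (δ ^ 2 * t n) +
      2 * (Real.exp (-((n : ℝ) ^ (-θ) * t n / 4)) + t n * (C * (Real.log n / n)))) atTop (𝓝 0) := by
  have concentration : Tendsto (fun n : ℕ => 2 / (δ ^ 2 * t n)) atTop (𝓝 0) :=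
    ((tendsto_natCast_atTop_atTop.comp ht).const_mul_atTop (by positivity)).const_div_atTop 2
  have absence := Real.tendsto_exp_neg_atTop_nhds_zero.comp (hθ.atTop_div_const four_pos)
  simpa [mul_left_comm] using
    concentration.add ((absence.add (hlog.const_mul C)).const_mul 2)

end Blocks

/-! ### Impossibility of exact recovery -/

section Impossibility

lemma tendsto_zero_of_le_div_add_mul {ι : Type*} {l : Filter ι} {c : ENNReal}
    {u v : ι → ENNReal} (hc : c ≠ ⊤) (hv : Tendsto v l (𝓝 0))
    (h : ∀ K : ℕ, 0 < K → ∀ᶠ i in l, u i ≤ c / K + K * v i) : Tendsto u l (𝓝 0) := by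
  refine ENNReal.tendsto_nhds_zero.2 fun ε hε => ?_
  have hε' : 0 < ε / 2 := ENNReal.half_pos hε.ne'
  have hdiv : Tendsto (fun K : ℕ => c / K) atTop (𝓝 0) := by
    simpa using ENNReal.Tendsto.const_div ENNReal.tendsto_nat_nhds_top (Or.inr hc)
  obtain ⟨K, hKε, hK⟩ := ((hdiv.eventually_le_const hε').and (eventually_gt_atTop 0)).exists
  have hmul : Tendsto (fun i => (K : ENNReal) * v i) l (𝓝 0) := by
    simpa using ENNReal.Tendsto.const_mul hv (Or.inr (ENNReal.natCast_ne_top K))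
  filter_upwards [h K hK, hmul.eventually_le_const hε'] with i hu hv
  exact hu.trans ((add_le_add hKε hv).trans_eq (ENNReal.add_halves ε))

variable {m : Marking (Bool × Bool)} {p q s : unitInterval} {n : ℕ}

lemma Marking.goodPair_subset_exchangeable {Φ : LabelMove n} {H : Finset (Fin n)} {k : ℕ}
    (h : ∀ (z : Config n), ∀ v ∈ H, ∀ w ∈ H, v ≠ w → z.pairs ∈ m.good H k z.labels v →
      z.pairs ∈ m.good H k z.labels w →
      edgeLaw p q s z.labels z.pairs ≤
        edgeLaw p q s (Φ.toFun (Equiv.swap v w) z).labels (Φ.toFun (Equiv.swap v w) z).pairs) :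
    m.goodPair k H ⊆ exchangeable (configLaw n p q s) Φ H := fun z hz => by
  obtain ⟨v, hv, hlabel, hgood⟩ := hz 1
  obtain ⟨w, hw, hlabel', hgood'⟩ := hz (-1)
  have labels_ne : z.labels v ≠ z.labels w := by
    rw [hlabel, hlabel']
    decide
  exact ⟨v, hv, w, hw, labels_ne, configLaw_le_configLaw p q s (Φ.labels_toFun _ z)
    (h z v hv w hw (ne_of_apply_ne _ labels_ne) hgood hgood')⟩

lemma union_goodPair_subset_exchangeable (hp : (p : ℝ) < 1) (hq : (q : ℝ) < 1)
    (s : unitInterval) (k : ℕ) (H : Finset (Fin n)) :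
    unionMarking.goodPair k H ⊆ exchangeable (configLaw n p q s) (relabelMove n) H :=
  Marking.goodPair_subset_exchangeable fun _ _ hv _ hw hvw hgood hgood' =>
    (edgeLaw_comp_swap_of_union_good hp hq s hv hw hvw hgood hgood').ge

lemma first_goodPair_subset_exchangeable (hp₀ : 0 < (p : ℝ)) (hp : (p : ℝ) < 1)
    (hq₀ : 0 < (q : ℝ)) (hq : (q : ℝ) < 1) (hs : (s : ℝ) < 1) (k : ℕ) (H : Finset (Fin n)) :
    firstMarking.goodPair k H ⊆ exchangeable (configLaw n p q s) (rematchMove n) H :=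
  Marking.goodPair_subset_exchangeable fun _ _ hv _ hw hvw hgood hgood' =>
    edgeLaw_le_of_first_good hp₀ hp hq₀ hq hs hv hw hvw hgood hgood'

lemma toOuterMeasure_recovered_le_of_goodPair {K t k : ℕ} {e : ENNReal} (hK : 0 < K)
    (hKt : K * t ≤ n) (P : PMF (Config n)) (est : Estimator n) {Φ : LabelMove n}
    (hΦ : ∀ H, m.goodPair k H ⊆ exchangeable P Φ H)
    (he : ∀ H : Finset (Fin n), H.card = t → P.toOuterMeasure (m.goodPair k H)ᶜ ≤ e) :
    P.toOuterMeasure (recovered est) ≤ 2 / K + K * e := by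
  obtain ⟨H, disjoint, card⟩ := exists_disjoint_blocks hKt
  calc P.toOuterMeasure (recovered est)
      ≤ 2 / K + ∑ j, P.toOuterMeasure (exchangeable P Φ (H j))ᶜ :=
        toOuterMeasure_recovered_le hK P est Φ disjoint
    _ ≤ 2 / K + ∑ _j : Fin K, e := by
        gcongr with j
        exact (P.toOuterMeasure.mono (Set.compl_subset_compl.2 (hΦ (H j)))).trans
          (he (H j) (card j))
    _ = 2 / K + K * e := by simp

variable {α β a b : ℝ} {p q : ℕ → unitInterval}

lemma tendsto_recovered (hα : 0 ≤ α) (hβ : 0 ≤ β) (h : m.HasRates s a b)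
    (hab : b * ((α + β) / 2) - a * √(α * β) < 1)
    (hp : ∀ᶠ n : ℕ in atTop, (p n : ℝ) = α * Real.log n / n)
    (hq : ∀ᶠ n : ℕ in atTop, (q n : ℝ) = β * Real.log n / n) {Φ : ∀ n, LabelMove n}
    (hΦ : ∀ᶠ n in atTop, ∀ k H,
      m.goodPair k H ⊆ exchangeable (configLaw n (p n) (q n) s) (Φ n) H)
    (est : ∀ n, Estimator n) :
    Tendsto (fun n => (configLaw n (p n) (q n) s).toOuterMeasure (recovered (est n)))
      atTop (𝓝 0) := by
  obtain ⟨δ, hδ, hδ', exponent_lt_one⟩ := exists_goodExponent_lt_one hab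
  obtain ⟨θ, hθ, hθ'⟩ := exists_between (max_lt zero_lt_one exponent_lt_one)
  obtain ⟨hθ₀, exponent_lt⟩ := max_lt_iff.1 hθ
  obtain ⟨t, ht, hexp, hlog⟩ := exists_blockSize hθ₀.le hθ'
  have error := ENNReal.tendsto_ofReal (tendsto_blockError hδ (max α β) ht hexp hlog)
  rw [ENNReal.ofReal_zero] at error
  refine tendsto_zero_of_le_div_add_mul (c := 2) ENNReal.ofNat_ne_top error fun K hK => ?_
  filter_upwards [hp, hq, hΦ, ht.eventually_gt_atTop 0, eventually_natCast_le_mul hlog hδ,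
    eventually_natCast_le_mul hlog (show (0 : ℝ) < (K : ℝ)⁻¹ by positivity),
    eventually_rpow_le_binomialWeight_mul hα hβ h.nonneg_marked h.nonneg_unneutral hδ hδ'
      exponent_lt] with n hpn hqn hΦn t_pos t_le K_mul_le weight
  have hKt : K * t n ≤ n := by
    rw [inv_mul_eq_div, le_div_iff₀' (by positivity)] at K_mul_le
    exact_mod_cast K_mul_le
  refine toOuterMeasure_recovered_le_of_goodPair (k := markedDegree α β a (Real.log n)) hK hKt _
    (est n) (hΦn _) fun H hH => ?_
  rw [← hpn, ← hqn] at weight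
  have max_eq : max α β * (Real.log n / n) = max (p n : ℝ) (q n) := by
    rw [max_mul_of_nonneg _ _ (div_nonneg (Real.log_natCast_nonneg n) (Nat.cast_nonneg n)),
      hpn, hqn, mul_div_assoc, mul_div_assoc]
  rw [max_eq, ← hH]
  rw [← hH] at t_pos t_le
  exact h.configLaw_compl_goodPair_le (Finset.card_pos.1 t_pos) hδ (by linarith) t_le
    (by positivity) weight

lemma eventually_edgeProbability_mem_Ioo (hα : 0 < α)
    (hp : ∀ᶠ n : ℕ in atTop, (p n : ℝ) = α * Real.log n / n) :
    ∀ᶠ n in atTop, (p n : ℝ) ∈ Set.Ioo 0 1 := by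
  filter_upwards [hp, eventually_mul_log_div_le α one_half_pos, eventually_gt_atTop 1]
    with n hpn le_half one_lt
  have log_pos : 0 < Real.log n := Real.log_pos (by exact_mod_cast one_lt)
  rw [hpn]
  exact ⟨by positivity, le_half.trans_lt one_half_lt_one⟩

lemma DPlus_eq (hα : 0 ≤ α) (hβ : 0 ≤ β) : DPlus α β = (α + β) / 2 - √(α * β) := by
  rw [DPlus, div_pow, Real.sq_sqrt zero_le_two, Real.sqrt_mul hα, sub_sq, Real.sq_sqrt hα,
    Real.sq_sqrt hβ]
  ring

lemma tendsto_recovered_of_union_lt (hα : 0 < α) (hβ : 0 < β)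
    (hp : ∀ᶠ n : ℕ in atTop, (p n : ℝ) = α * Real.log n / n)
    (hq : ∀ᶠ n : ℕ in atTop, (q n : ℝ) = β * Real.log n / n)
    (h : (1 - (1 - (s : ℝ)) ^ 2) * DPlus α β < 1) (est : ∀ n, Estimator n) :
    Tendsto (fun n => (configLaw n (p n) (q n) s).toOuterMeasure (recovered (est n)))
      atTop (𝓝 0) := by
  rw [DPlus_eq hα.le hβ.le, mul_sub] at h
  refine tendsto_recovered hα.le hβ.le (unionMarking_hasRates s) h hp hq
    (Φ := relabelMove) ?_ est
  filter_upwards [eventually_edgeProbability_mem_Ioo hα hp,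
    eventually_edgeProbability_mem_Ioo hβ hq] with n hpn hqn
  exact union_goodPair_subset_exchangeable hpn.2 hqn.2 s

lemma tendsto_recovered_of_first_lt (hα : 0 < α) (hβ : 0 < β) (hs : (s : ℝ) < 1)
    (hp : ∀ᶠ n : ℕ in atTop, (p n : ℝ) = α * Real.log n / n)
    (hq : ∀ᶠ n : ℕ in atTop, (q n : ℝ) = β * Real.log n / n)
    (h : (s : ℝ) ^ 2 * Tc α β + s * (1 - (s : ℝ)) * DPlus α β < 1) (est : ∀ n, Estimator n) :
    Tendsto (fun n => (configLaw n (p n) (q n) s).toOuterMeasure (recovered (est n)))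
      atTop (𝓝 0) := by
  rw [DPlus_eq hα.le hβ.le, Tc] at h
  refine tendsto_recovered hα.le hβ.le (firstMarking_hasRates s) (by linarith) hp hq
    (Φ := rematchMove) ?_ est
  filter_upwards [eventually_edgeProbability_mem_Ioo hα hp,
    eventually_edgeProbability_mem_Ioo hβ hq] with n hpn hqn
  exact first_goodPair_subset_exchangeable hpn.1 hpn.2 hqn.1 hqn.2 hs

lemma union_lt_of_first_lt_of_eq_one (hα : 0 ≤ α) (hβ : 0 ≤ β) (hs : (s : ℝ) = 1)
    (h : (s : ℝ) ^ 2 * Tc α β + s * (1 - (s : ℝ)) * DPlus α β < 1) :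
    (1 - (1 - (s : ℝ)) ^ 2) * DPlus α β < 1 := by
  rw [hs, Tc] at h
  rw [hs, DPlus_eq hα hβ]
  linarith [Real.sqrt_nonneg (α * β)]

end Impossibility

end CorrelatedSBM

theorem theorem2 (α β : ℝ) (hα : 0 < α) (hβ : 0 < β) (s : unitInterval) (p q : ℕ → unitInterval)
    (hp : ∀ᶠ n : ℕ in atTop, (p n : ℝ) = α * Real.log n / n)
    (hq : ∀ᶠ n : ℕ in atTop, (q n : ℝ) = β * Real.log n / n)
    (h : (1 - (1 - (s : ℝ)) ^ 2) * DPlus α β < 1 ∨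
      (s : ℝ) ^ 2 * Tc α β + (s : ℝ) * (1 - (s : ℝ)) * DPlus α β < 1)
    (σ' : ∀ n : ℕ, Estimator n) :
    Tendsto (fun n : ℕ => (CSBM n (p n) (q n) s).toMeasure
      {ω | overlap (σ' n ω.G₁ ω.G₂) ω.σ = 1}) atTop (𝓝 0) := by
  simp only [CSBM_toMeasure_overlap_eq_one]
  rcases h with h | h
  · exact tendsto_recovered_of_union_lt hα hβ hp hq h σ'
  rcases (show (s : ℝ) ≤ 1 from s.2.2).eq_or_lt with hs | hs
  · exact tendsto_recovered_of_union_lt hα hβ hp hq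
      (union_lt_of_first_lt_of_eq_one hα.le hβ.le hs h) σ'
  · exact tendsto_recovered_of_first_lt hα hβ hs hp hq h σ'
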